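/- Let $r,s,t\ge 0$ be integers, let $\mathbb P^1$ be the complex projective line and $\mathbb H$ the upper half plane, let $\operatorname{Aut}$ denote the group of biholomorphic self-maps, and let $p_2:(\mathbb P^1)^r\times\mathbb C^s\times\mathbb H^t\to\mathbb C^s\times\mathbb H^t$ be the projection. A group $\Gamma$ of automorphisms acts *freely* if no element other than the identity has a fixed point, and *properly discontinuously* if $\{\gamma\in\Gamma:\gamma K\cap L\neq\emptyset\}$ is finite for all compact sets $K,L$. There is a group homomorphism $$\Phi:\operatorname{Aut}\big((\mathbb P^1)^r\times\mathbb C^s\times\mathbb H^t\big)\to\operatorname{Aut}\big(\mathbb C^s\times\mathbb H^t\big)$$ such that $\Phi(\varphi)\circ p_2=p_2\circ\varphi$ for every $\varphi$ (this determines $\Phi$), with the following properties. 1. If $\Gamma\subset\operatorname{Aut}((\mathbb P^1)^r\times\mathbb C^s\times\mathbb H^t)$ is a subgroup that acts freely, then $\Phi$ is injective on $\Gamma$ and $\Gamma_2:=\Phi(\Gamma)$ acts freely on $\mathbb C^s\times\mathbb H^t$. 2. If a subgroup $\Gamma$ acts properly discontinuously, then so does $\Gamma_2=\Phi(\Gamma)$.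 3. If a subgroup $\Gamma$ acts freely and properly discontinuously (in particular if, moreover, its quotient is compact), then, for the natural structures on the quotients, which are complex manifolds, the map $$\big((\mathbb P^1)^r\times\mathbb C^s\times\mathbb H^t\big)/\Gamma\to(\mathbb C^s\times\mathbb H^t)/\Gamma_2$$ induced by $p_2$ is a holomorphic fibre bundle with fibre $(\mathbb P^1)^r$: every point of the base has an open neighbourhood $U$ whose preimage is biholomorphic to $U\times(\mathbb P^1)^r$ compatibly with the projections to $U$. -/

import Mathlib

open scoped Manifold ContDiff UpperHalfPlane Topology

noncomputable section

/-! ### The Riemann sphere as a complex manifold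

The complex projective line is realised as the one-point compactification `ℂ ∪ {∞}`, with the two
standard affine charts `z` (off `∞`) and `1 / z` (off `0`). -/

namespace RiemannSphere

/-- The inversion `z ↦ 1 / z` of `ℂ ∪ {∞}`, exchanging `0` and `∞`. -/
def inv (x : OnePoint ℂ) : OnePoint ℂ :=
  x.elim ((0 : ℂ) : OnePoint ℂ) fun z => if z = 0 then OnePoint.infty else ((z⁻¹ : ℂ) : OnePoint ℂ)

theorem inv_infty : inv OnePoint.infty = ((0 : ℂ) : OnePoint ℂ) := rfl

theorem inv_zero : inv ((0 : ℂ) : OnePoint ℂ) = OnePoint.infty := by simp [inv]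

theorem inv_coe {z : ℂ} (hz : z ≠ 0) : inv (z : OnePoint ℂ) = ((z⁻¹ : ℂ) : OnePoint ℂ) := by
  simp [inv, hz]

theorem inv_inv (x : OnePoint ℂ) : inv (inv x) = x := by
  induction x using OnePoint.rec with
  | infty => rw [inv_infty, inv_zero]
  | coe z =>
    by_cases hz : z = 0
    · subst hz; rw [inv_zero, inv_infty]
    · rw [inv_coe hz, inv_coe (inv_ne_zero hz), _root_.inv_inv]

theorem continuous_inv : Continuous inv := by
  rw [OnePoint.continuous_iff]
  constructor
  · rw [inv_infty, Filter.coclosedCompact_eq_cocompact]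
    have h1 : Filter.Tendsto (fun z : ℂ => ((z⁻¹ : ℂ) : OnePoint ℂ)) (Filter.cocompact ℂ)
        (𝓝 ((0 : ℂ) : OnePoint ℂ)) :=
      (OnePoint.continuous_coe.tendsto (0 : ℂ)).comp ((by rw [← Metric.cobounded_eq_cocompact]; exact Filter.tendsto_inv₀_cobounded))
    refine h1.congr' ?_
    have h0 : ∀ᶠ z : ℂ in Filter.cocompact ℂ, z ≠ 0 := by
      have := (isCompact_singleton (x := (0 : ℂ))).compl_mem_cocompact
      filter_upwards [this] with z hz using hz
    filter_upwards [h0] with z hz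
    rw [inv_coe hz]
  · rw [continuous_iff_continuousAt]
    intro z
    by_cases hz : z = 0
    · subst hz
      rw [ContinuousAt, inv_zero, ← nhdsNE_sup_pure, Filter.tendsto_sup]
      refine ⟨?_, by rw [← inv_zero]; exact tendsto_pure_nhds _ _⟩
      have h1 : Filter.Tendsto (fun z : ℂ => ((z⁻¹ : ℂ) : OnePoint ℂ)) (𝓝[≠] 0)
          (𝓝 OnePoint.infty) := by
        refine OnePoint.tendsto_coe_infty.comp ?_
        rw [Filter.coclosedCompact_eq_cocompact, ← Metric.cobounded_eq_cocompact]
        exact Filter.tendsto_inv₀_nhdsNE_zero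
      refine h1.congr' ?_
      filter_upwards [self_mem_nhdsWithin] with w hw
      rw [inv_coe hw]
    · have h1 : ContinuousAt (fun z : ℂ => ((z⁻¹ : ℂ) : OnePoint ℂ)) z :=
        OnePoint.continuous_coe.continuousAt.comp (continuousAt_inv₀ hz)
      refine h1.congr ?_
      filter_upwards [isOpen_ne.mem_nhds hz] with w hw
      rw [inv_coe hw]

/-- The inversion as a homeomorphism. -/
def invHomeo : OnePoint ℂ ≃ₜ OnePoint ℂ where
  toFun := inv
  invFun := inv
  left_inv := inv_inv
  right_inv := inv_inv
  continuous_toFun := continuous_inv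
  continuous_invFun := continuous_inv

/-- The affine chart `z`, defined off `∞`, with values in all of `ℂ`. -/
def chartZero : OpenPartialHomeomorph (OnePoint ℂ) ℂ :=
  (OnePoint.isOpenEmbedding_coe.toOpenPartialHomeomorph ((↑) : ℂ → OnePoint ℂ)).symm

/-- The affine chart `1 / z`, defined off `0`, with values in all of `ℂ`. -/
def chartInfty : OpenPartialHomeomorph (OnePoint ℂ) ℂ :=
  invHomeo.toOpenPartialHomeomorph.trans chartZero

theorem chartZero_source : chartZero.source = Set.range ((↑) : ℂ → OnePoint ℂ) := by
  simp [chartZero]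

theorem infty_mem_chartInfty_source : OnePoint.infty ∈ chartInfty.source := by
  simp [chartInfty, chartZero, invHomeo, inv_infty]

open Classical in
instance : ChartedSpace ℂ (OnePoint ℂ) where
  atlas := {chartZero, chartInfty}
  chartAt x := if x = OnePoint.infty then chartInfty else chartZero
  mem_chart_source x := by
    by_cases hx : x = OnePoint.infty
    · subst hx; simpa using infty_mem_chartInfty_source
    · simpa [hx, chartZero_source] using OnePoint.ne_infty_iff_exists.1 hx
  chart_mem_atlas x := by
    by_cases hx : x = OnePoint.infty <;> simp [hx]

theorem chartZero_coe (z : ℂ) : chartZero (z : OnePoint ℂ) = z :=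
  (OnePoint.isOpenEmbedding_coe.toOpenPartialHomeomorph ((↑) : ℂ → OnePoint ℂ)).left_inv
    (by simp)

theorem chartZero_symm (z : ℂ) : chartZero.symm z = (z : OnePoint ℂ) := by simp [chartZero]

theorem chartInfty_apply (x : OnePoint ℂ) : chartInfty x = chartZero (inv x) := rfl

theorem chartInfty_symm (z : ℂ) : chartInfty.symm z = inv (z : OnePoint ℂ) := by
  rw [← chartZero_symm]; rfl

theorem transition_contDiffOn :
    ContDiffOn ℂ ω (fun z : ℂ => chartZero (inv (z : OnePoint ℂ)))
      {z | inv (z : OnePoint ℂ) ∈ chartZero.source} := by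
  have hne : ∀ z ∈ {z : ℂ | inv (z : OnePoint ℂ) ∈ chartZero.source}, z ≠ 0 := by
    rintro z hz rfl
    have hz2 : inv ((0 : ℂ) : OnePoint ℂ) ∈ chartZero.source := hz
    rw [inv_zero, chartZero_source] at hz2
    exact OnePoint.infty_notMem_range_coe hz2
  refine (contDiffOn_id.inv hne).congr fun z hz => ?_
  rw [inv_coe (hne z hz), chartZero_coe]; rfl

/-- The two affine charts are holomorphically compatible: the sphere is a complex manifold. -/
instance : IsManifold 𝓘(ℂ) ω (OnePoint ℂ) := by
  refine isManifold_of_contDiffOn _ _ _ fun e e' he he' => ?_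
  have hdiag : ∀ e : OpenPartialHomeomorph (OnePoint ℂ) ℂ,
      ContDiffOn ℂ ω (fun z => e (e.symm z)) e.target := fun e =>
    contDiffOn_id.congr fun z hz => e.right_inv hz
  have he2 : e = chartZero ∨ e = chartInfty := he
  have he2' : e' = chartZero ∨ e' = chartInfty := he'
  rcases he2 with rfl | rfl <;> rcases he2' with rfl | rfl
  · exact (hdiag chartZero).mono fun z hz => hz.1.1
  · refine (transition_contDiffOn.mono fun z hz => ?_).congr fun z hz => ?_
    · have h2 : chartZero.symm z ∈ chartInfty.source := hz.1.2
      rw [chartZero_symm] at h2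
      exact h2.2
    · change chartInfty (chartZero.symm z) = _
      rw [chartZero_symm, chartInfty_apply]
  · refine (transition_contDiffOn.mono fun z hz => ?_).congr fun z hz => ?_
    · have h2 : chartInfty.symm z ∈ chartZero.source := hz.1.2
      rwa [chartInfty_symm] at h2
    · change chartZero (chartInfty.symm z) = _
      rw [chartInfty_symm]
  · exact (hdiag chartInfty).mono fun z hz => hz.1.1

end RiemannSphere

/-! ### Automorphism groups of complex manifolds -/

section Automorphisms

variable {E : Type*} [NormedAddCommGroup E] [NormedSpace ℂ E] {H : Type*} [TopologicalSpace H]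

/-- The group of biholomorphic self-maps of `M` (over `ℂ`, holomorphic means complex analytic,
i.e. of class `C^ω`), under composition. It acts on `M` by evaluation. -/
def HolAut (I : ModelWithCorners ℂ E H) (M : Type*) [TopologicalSpace M] [ChartedSpace H M] :
    Subgroup (Equiv.Perm M) where
  carrier := {f | ContMDiff I I ω f ∧ ContMDiff I I ω f.symm}
  mul_mem' hf hg := ⟨hf.1.comp hg.1, hg.2.comp hf.2⟩
  one_mem' := ⟨contMDiff_id, contMDiff_id⟩
  inv_mem' hf := ⟨hf.2, hf.1⟩

section Actions

variable (I : ModelWithCorners ℂ E H) (M : Type*) [TopologicalSpace M] [ChartedSpace H M]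

/-- The evaluation action `f • x = f x` of a group of automorphisms. -/
instance (Γ : Subgroup (HolAut I M)) : MulAction Γ M := inferInstance

instance (Γ : Subgroup (HolAut I M)) : SMul Γ M := inferInstance

variable {I M} in
theorem HolAut.smul_eq {Γ : Subgroup (HolAut I M)} (f : Γ) (x : M) : f • x = f.1.1 x := rfl

instance (Γ : Subgroup (HolAut I M)) : ContinuousConstSMul Γ M where
  continuous_const_smul f := f.1.2.1.continuous

end Actions

end Automorphisms

/-! ### Holomorphic fibre bundles -/

/-- `π : X → B` is a holomorphic fibre bundle with fibre `F`: `X` and `B` are complex manifolds and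
every point of `B` has an open neighbourhood `U` with a biholomorphism `π ⁻¹ U ≃ U × F` commuting
with the projections to `U`. -/
structure IsHolomorphicFiberBundle
    {EX EB EF : Type*} [NormedAddCommGroup EX] [NormedSpace ℂ EX]
    [NormedAddCommGroup EB] [NormedSpace ℂ EB] [NormedAddCommGroup EF] [NormedSpace ℂ EF]
    {HX HB HF : Type*} [TopologicalSpace HX] [TopologicalSpace HB] [TopologicalSpace HF]
    (IX : ModelWithCorners ℂ EX HX) (IB : ModelWithCorners ℂ EB HB)
    (IF : ModelWithCorners ℂ EF HF) {X B : Type*} (F : Type*)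
    [TopologicalSpace X] [ChartedSpace HX X] [TopologicalSpace B] [ChartedSpace HB B]
    [TopologicalSpace F] [ChartedSpace HF F] (π : X → B) : Prop where
  isManifold_total : IsManifold IX ω X
  isManifold_base : IsManifold IB ω B
  exists_trivialization : ∀ b : B, ∃ e : Bundle.Trivialization F π, b ∈ e.baseSet ∧
    ContMDiffOn IX (IB.prod IF) ω e e.source ∧
    ContMDiffOn (IB.prod IF) IX ω e.toOpenPartialHomeomorph.symm e.target

/-! ### Products of copies of the three simply connected curves

All products carry the product manifold structure. -/

/-- `(ℙ¹)^r`. -/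
abbrev PPow (r : ℕ) : Type := Fin r → OnePoint ℂ

/-- `ℂ^s × ℍ^t`. -/
abbrev CHProd (s t : ℕ) : Type := (Fin s → ℂ) × (Fin t → ℍ)

/-- `(ℙ¹)^r × ℂ^s × ℍ^t`. -/
abbrev PCHProd (r s t : ℕ) : Type := PPow r × CHProd s t

/-- The model of an `n`-fold product of one-dimensional complex manifolds. -/
abbrev modelPow (n : ℕ) : ModelWithCorners ℂ (Fin n → ℂ) (ModelPi fun _ : Fin n => ℂ) :=
  ModelWithCorners.pi fun _ : Fin n => 𝓘(ℂ)

/-- The model of `ℂ^s × ℍ^t`. -/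
abbrev modelCH (s t : ℕ) :
    ModelWithCorners ℂ ((Fin s → ℂ) × (Fin t → ℂ))
      (ModelProd (Fin s → ℂ) (ModelPi fun _ : Fin t => ℂ)) :=
  𝓘(ℂ, Fin s → ℂ).prod (modelPow t)

/-- The model of `(ℙ¹)^r × ℂ^s × ℍ^t`. -/
abbrev modelPCH (r s t : ℕ) :
    ModelWithCorners ℂ ((Fin r → ℂ) × ((Fin s → ℂ) × (Fin t → ℂ)))
      (ModelProd (ModelPi fun _ : Fin r => ℂ)
        (ModelProd (Fin s → ℂ) (ModelPi fun _ : Fin t => ℂ))) :=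
  (modelPow r).prod (modelCH s t)

/-- `Aut(ℂ^s × ℍ^t)`. -/
abbrev AutCH (s t : ℕ) : Subgroup (Equiv.Perm (CHProd s t)) :=
  HolAut (modelCH s t) (CHProd s t)

/-- `Aut((ℙ¹)^r × ℂ^s × ℍ^t)`. -/
abbrev AutPCH (r s t : ℕ) : Subgroup (Equiv.Perm (PCHProd r s t)) :=
  HolAut (modelPCH r s t) (PCHProd r s t)

end

open scoped Manifold ContDiff UpperHalfPlane Topology

noncomputable section

/-! ### Finite products of manifolds -/

section PiManifold

variable {𝕜 : Type*} [NontriviallyNormedField 𝕜] {ι : Type*} [Fintype ι]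
  {E : ι → Type*} [∀ i, NormedAddCommGroup (E i)] [∀ i, NormedSpace 𝕜 (E i)]
  {H : ι → Type*} [∀ i, TopologicalSpace (H i)] {I : ∀ i, ModelWithCorners 𝕜 (E i) (H i)}
  {N : ι → Type*} [∀ i, TopologicalSpace (N i)] [∀ i, ChartedSpace (H i) (N i)]
  {E' : Type*} [NormedAddCommGroup E'] [NormedSpace 𝕜 E'] {H' : Type*} [TopologicalSpace H']
  {I' : ModelWithCorners 𝕜 E' H'} {M : Type*} [TopologicalSpace M] [ChartedSpace H' M]
  {n : ℕ∞ω}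

/-! Since `(ℙ¹)^r` is compact and connected, holomorphic maps from it to `ℂ^s × ℍ^t` are constant
(`apply_eq_of_contMDiff`). Every automorphism `φ` therefore carries fibres of the projection into
fibres and descends to the base; this gives `projHom`. Proper discontinuity descends because the
fibre is compact.

Freeness descends because every automorphism of `(ℙ¹)^r` has a fixed point
(`PPow.exists_fixedPoint`): if the image of `γ` fixes `y`, then `γ` restricts to an automorphism of
the fibre over `y`, hence fixes a point of it, hence is trivial. The same argument, applied to `γ⁻¹
* γ'`, gives injectivity.

The fixed point comes from two facts. First, automorphisms of `(ℙ¹)^r` permute the factors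
(`PPow.exists_perm`). The inverse Jacobian determinant in affine coordinates, set to zero where the
image leaves `ℂ^r`, is entire. If two components varied along one coordinate line, Möbius changes of
coordinates would give both a pole at the infinite point of the line and all components finite
values at another point. The two poles force the inverse Jacobian to tend to zero along the line, so
it vanishes there by Liouville, although it is nonzero at the finite point. Second, a holomorphic
self-map `g` of `ℙ¹` has a fixed point, since otherwise `1 / (g z - z)` contradicts Liouville.
Composing around the cycles of the permutation reduces the first situation to the second.

For the bundle, an open `V` in the base that meets none of its other translates has the preimage
`(ℙ¹)^r × V`, which embeds in the quotient because `Γ` is isomorphic to its image; this is a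
trivialization. -/

theorem contMDiffWithinAt_pi_iff {f : M → ∀ i, N i} {s : Set M} {x : M} :
    ContMDiffWithinAt I' (ModelWithCorners.pi I) n f s x ↔
      ∀ i, ContMDiffWithinAt I' (I i) n (fun y => f y i) s x := by
  simp only [contMDiffWithinAt_iff, continuousWithinAt_pi, forall_and]
  refine and_congr Iff.rfl ?_
  rw [contDiffWithinAt_pi]
  rfl

theorem contMDiff_pi_iff {f : M → ∀ i, N i} :
    ContMDiff I' (ModelWithCorners.pi I) n f ↔
      ∀ i, ContMDiff I' (I i) n (fun y => f y i) := by
  simp only [ContMDiff, ← contMDiffWithinAt_univ, contMDiffWithinAt_pi_iff]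
  exact forall_comm

theorem contMDiff_pi_apply (i : ι) :
    ContMDiff (ModelWithCorners.pi I) (I i) n (fun x : ∀ i, N i => x i) :=
  contMDiff_pi_iff.1 contMDiff_id i

instance isManifold_pi [∀ i, IsManifold (I i) n (N i)] :
    IsManifold (ModelWithCorners.pi I) n (∀ i, N i) := by
  refine isManifold_of_contDiffOn _ _ _ ?_
  rintro _ _ ⟨e, he, rfl⟩ ⟨e', he', rfl⟩
  rw [contDiffOn_pi]
  intro i
  have h := (contDiffGroupoid n (I i)).compatible (he i trivial) (he' i trivial)
  refine (h.1.comp (ContinuousLinearMap.proj (R := 𝕜) (φ := E) i).contDiff.contDiffOn ?_)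
  rintro _ ⟨hx, y, rfl⟩
  refine ⟨?_, y i, rfl⟩
  have h1 : (ModelWithCorners.pi I).symm (ModelWithCorners.pi I y) ∈
    ((OpenPartialHomeomorph.pi e).symm ≫ₕ OpenPartialHomeomorph.pi e').source := hx
  exact ⟨h1.1 i trivial, h1.2 i trivial⟩

end PiManifold

/-! ### Quotient manifolds -/

section QuotientManifold

open MulAction Filter

variable {𝕜 : Type*} [NontriviallyNormedField 𝕜] {E : Type*} [NormedAddCommGroup E]
  [NormedSpace 𝕜 E] {H : Type*} [TopologicalSpace H] {I : ModelWithCorners 𝕜 E H}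
  {M : Type*} [TopologicalSpace M] [ChartedSpace H M] [T2Space M] [LocallyCompactSpace M]
  {G : Type*} [Group G] [MulAction G M] [ProperlyDiscontinuousSMul G M] [ContinuousConstSMul G M]
  [IsCancelSMul G M] {n : ℕ∞ω}

omit [ChartedSpace H M] in
variable (M G) in
theorem isLocalHomeomorph_orbit_mk :
    IsLocalHomeomorph (Quotient.mk (orbitRel G M)) :=
  isQuotientCoveringMap_quotientMk_of_properlyDiscontinuousSMul.isCoveringMap.isLocalHomeomorph

/-- Unfolds the charts of the quotient: a local inverse of the orbit map followed by a chart of `M`.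
-/
theorem quotient_chartAt (y : orbitRel.Quotient G M) : ∃ x : M, Quotient.mk (orbitRel G M) x = y ∧
    chartAt H y = ((isLocalHomeomorph_orbit_mk M G).localInverseAt x).trans (chartAt H x) :=
  ⟨_, (Quotient.mk_surjective (s := orbitRel G M)).hasRightInverse.choose_spec y, rfl⟩

theorem mem_atlas_quotient {e : OpenPartialHomeomorph (orbitRel.Quotient G M) H}
    (he : e ∈ atlas H (orbitRel.Quotient G M)) : ∃ x : M,
    e = ((isLocalHomeomorph_orbit_mk M G).localInverseAt x).trans (chartAt H x) := by
  obtain ⟨q, rfl⟩ := he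
  exact ⟨_, rfl⟩

/-- Near `m` this composite is the action of a single group element, since two points of one orbit
in the domain of injectivity of the local inverse coincide. All smoothness statements about the
quotient reduce to this. -/
theorem contMDiffAt_localInverseAt_comp_mk (hG : ∀ g : G, ContMDiff I I n fun x : M => g • x)
    {x m : M}
    (hm : Quotient.mk (orbitRel G M) m ∈ ((isLocalHomeomorph_orbit_mk M G).localInverseAt x).source) :
    ContMDiffAt I I n (fun m => (isLocalHomeomorph_orbit_mk M G).localInverseAt x
      (Quotient.mk (orbitRel G M) m)) m := by
  set hf := isLocalHomeomorph_orbit_mk M G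
  set s := hf.localInverseAt x
  obtain ⟨g, hg⟩ : ∃ g : G, g • m = s (Quotient.mk (orbitRel G M) m) := by
    have := hf.apply_localInverseAt_of_mem hm
    exact Quotient.exact this
  refine ((hG g) m).congr_of_eventuallyEq ?_
  have h1 : ∀ᶠ m' in 𝓝 m, g • m' ∈ s.target :=
    (hG g).continuous.continuousAt.eventually_mem (s.open_target.mem_nhds (hg ▸ s.map_source hm))
  have h2 : ∀ᶠ m' in 𝓝 m, Quotient.mk (orbitRel G M) m' ∈ s.source :=
    hf.continuous.continuousAt.eventually_mem (s.open_source.mem_nhds hm)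
  filter_upwards [h1, h2] with m' h1 h2
  refine hf.injOn_localInverseAt_target (s.map_source h2) h1 ?_
  rw [hf.apply_localInverseAt_of_mem h2]
  exact Quotient.sound ⟨g⁻¹, by simp⟩

theorem isManifold_quotient [IsManifold I n M] (hG : ∀ g : G, ContMDiff I I n fun x : M => g • x) :
    IsManifold I n (orbitRel.Quotient G M) := by
  refine isManifold_of_contDiffOn _ _ _ fun e e' he he' => ?_
  obtain ⟨a, rfl⟩ := mem_atlas_quotient he
  obtain ⟨b, rfl⟩ := mem_atlas_quotient he'
  set hf := isLocalHomeomorph_orbit_mk M G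
  rw [← contMDiffOn_iff_contDiffOn]
  rintro z ⟨hz, w, rfl⟩
  have hw : w ∈ (((hf.localInverseAt a).trans (chartAt H a)).symm.trans
    ((hf.localInverseAt b).trans (chartAt H b))).source := by simpa using hz
  have hw1 : w ∈ (chartAt H a).target := hw.1.1
  have hw2 : Quotient.mk (orbitRel G M) ((chartAt H a).symm w) ∈ (hf.localInverseAt b).source := by
    have := hw.2.1
    simpa [hf] using this
  have hw3 : hf.localInverseAt b (Quotient.mk (orbitRel G M) ((chartAt H a).symm w)) ∈
      (chartAt H b).source := by
    have := hw.2.2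
    simpa [hf] using this
  have k1 : ContMDiffWithinAt 𝓘(𝕜, E) I n (I.symm) (Set.range I) (I w) :=
    I.contMDiffOn_symm _ ⟨w, rfl⟩
  have k2 : ContMDiffAt I I n (chartAt H a).symm w :=
    (contMDiffOn_chart_symm (I := I)).contMDiffAt ((chartAt H a).open_target.mem_nhds hw1)
  have k3 := contMDiffAt_localInverseAt_comp_mk hG hw2
  have k4 : ContMDiffAt I I n (chartAt H b) _ :=
    (contMDiffOn_chart (I := I)).contMDiffAt ((chartAt H b).open_source.mem_nhds hw3)
  have k34 := ContMDiffAt.comp (g := chartAt H b)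
    (f := fun m => hf.localInverseAt b (Quotient.mk (orbitRel G M) m)) _ k4 k3
  have k5 := (I.contMDiff (n := n) _).comp _ (k34.comp _ k2)
  have k6 := ContMDiffAt.comp_contMDiffWithinAt_of_eq k5 k1 (I.left_inv w)
  refine (k6.mono Set.inter_subset_right).congr (fun y hy => ?_) ?_
  · simp [Function.comp_def]
  · simp [Function.comp_def]

theorem contMDiff_quotient_mk [IsManifold I n M]
    (hG : ∀ g : G, ContMDiff I I n fun x : M => g • x) :
    ContMDiff I I n (Quotient.mk (orbitRel G M) : M → orbitRel.Quotient G M) := by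
  intro m
  rw [contMDiffAt_iff_target]
  refine ⟨(isLocalHomeomorph_orbit_mk M G).continuous.continuousAt, ?_⟩
  obtain ⟨b, hb, hc⟩ := quotient_chartAt (H := H) (Quotient.mk (orbitRel G M) m : orbitRel.Quotient G M)
  rw [extChartAt, hc]
  set hf := isLocalHomeomorph_orbit_mk M G
  have h1 : Quotient.mk (orbitRel G M) m ∈ (hf.localInverseAt b).source := by
    rw [← hb]; exact hf.apply_self_mem_localInverseAt_source
  have h2 : hf.localInverseAt b (Quotient.mk (orbitRel G M) m) ∈ (chartAt H b).source := by
    rw [← hb, hf.localInverseAt_apply_self]; exact mem_chart_source H b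
  have k4 : ContMDiffAt I I n (chartAt H b) _ :=
    (contMDiffOn_chart (I := I)).contMDiffAt ((chartAt H b).open_source.mem_nhds h2)
  exact (I.contMDiff (n := n) _).comp _ (ContMDiffAt.comp (g := chartAt H b)
    (f := fun m => hf.localInverseAt b (Quotient.mk (orbitRel G M) m)) _ k4
    (contMDiffAt_localInverseAt_comp_mk hG h1))

/-- In the chart at `y` the orbit map is inverted by a chart of `M`, so that the local inverse
becomes a composite of the form treated in `contMDiffAt_localInverseAt_comp_mk`. -/
theorem contMDiffAt_localInverseAt [IsManifold I n M]
    (hG : ∀ g : G, ContMDiff I I n fun x : M => g • x) {x : M} {y : orbitRel.Quotient G M}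
    (hy : y ∈ ((isLocalHomeomorph_orbit_mk M G).localInverseAt x).source) :
    ContMDiffAt I I n ((isLocalHomeomorph_orbit_mk M G).localInverseAt x) y := by
  have := isManifold_quotient (I := I) (n := n) hG
  obtain ⟨b, rfl, hc⟩ := quotient_chartAt (H := H) y
  set hf := isLocalHomeomorph_orbit_mk M G
  set q : M → orbitRel.Quotient G M := Quotient.mk (orbitRel G M)
  have h1 : ContMDiffAt I I n (chartAt H (q b)) (q b) :=
    (contMDiffOn_chart (I := I)).contMDiffAt
      ((chartAt H (q b)).open_source.mem_nhds (mem_chart_source H _))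
  have hbb : chartAt H (q b) (q b) = chartAt H b b := by
    rw [hc]; simp [q]
  have h2 : ContMDiffAt I I n (chartAt H b).symm (chartAt H (q b) (q b)) := by
    rw [hbb]
    exact (contMDiffOn_chart_symm (I := I)).contMDiffAt
      ((chartAt H b).open_target.mem_nhds (mem_chart_target H b))
  have hb : (chartAt H b).symm (chartAt H (q b) (q b)) = b := by
    rw [hbb]; exact (chartAt H b).left_inv (mem_chart_source H b)
  have h3 : ContMDiffAt I I n (fun m => hf.localInverseAt x (q m))
      ((chartAt H b).symm (chartAt H (q b) (q b))) := by
    rw [hb]; exact contMDiffAt_localInverseAt_comp_mk hG hy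
  refine ((h3.comp _ h2).comp _ h1).congr_of_eventuallyEq ?_
  filter_upwards [(chartAt H (q b)).open_source.mem_nhds (mem_chart_source H (q b))] with y' hy'
  have e1 : q ((chartAt H b).symm (chartAt H (q b) y')) = y' := by
    rw [hc] at hy' ⊢
    exact (congrArg q ((chartAt H b).left_inv hy'.2)).trans
      (hf.apply_localInverseAt_of_mem hy'.1)
  simp only [Function.comp_apply, e1]

/-- Continuous local sections of the quotient map are smooth. -/
theorem contMDiffAt_of_eventually_mk_eq [IsManifold I n M]
    (hG : ∀ g : G, ContMDiff I I n fun x : M => g • x) {σ : orbitRel.Quotient G M → M}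
    {y : orbitRel.Quotient G M} (hσ : ContinuousAt σ y)
    (h : ∀ᶠ y' in 𝓝 y, Quotient.mk (orbitRel G M) (σ y') = y') : ContMDiffAt I I n σ y := by
  set hf := isLocalHomeomorph_orbit_mk M G
  have hy : y ∈ (hf.localInverseAt (σ y)).source := by
    have := hf.apply_self_mem_localInverseAt_source (x := σ y)
    rwa [h.self_of_nhds] at this
  refine (contMDiffAt_localInverseAt hG hy).congr_of_eventuallyEq ?_
  filter_upwards [h, (hf.localInverseAt (σ y)).open_source.mem_nhds hy,
    hσ.eventually_mem ((hf.localInverseAt (σ y)).open_target.mem_nhds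
      hf.self_mem_localInverseAt_target)] with y' h1 h2 h3
  exact hf.injOn_localInverseAt_target h3 ((hf.localInverseAt (σ y)).map_source h2)
    (h1.trans (hf.apply_localInverseAt_of_mem h2).symm)

end QuotientManifold

/-! ### Holomorphic maps to and from the Riemann sphere -/

namespace RiemannSphere

open Filter

theorem chartZero_mem_maximalAtlas : chartZero ∈ IsManifold.maximalAtlas 𝓘(ℂ) ω (OnePoint ℂ) :=
  IsManifold.subset_maximalAtlas (Or.inl rfl)

theorem chartInfty_mem_maximalAtlas : chartInfty ∈ IsManifold.maximalAtlas 𝓘(ℂ) ω (OnePoint ℂ) :=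
  IsManifold.subset_maximalAtlas (Or.inr rfl)

theorem mem_chartZero_source {x : OnePoint ℂ} : x ∈ chartZero.source ↔ x ≠ OnePoint.infty := by
  rw [chartZero_source, OnePoint.ne_infty_iff_exists]; rfl

theorem coe_chartZero {x : OnePoint ℂ} (hx : x ≠ OnePoint.infty) : ((chartZero x : ℂ) : OnePoint ℂ) = x := by
  rw [← chartZero_symm]
  exact chartZero.left_inv (mem_chartZero_source.2 hx)

theorem contMDiff_coe : ContMDiff 𝓘(ℂ) 𝓘(ℂ) ω ((↑) : ℂ → OnePoint ℂ) := by
  have := contMDiffOn_symm_of_mem_maximalAtlas chartZero_mem_maximalAtlas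
  intro z
  refine (this.contMDiffAt (x := z) (chartZero.open_target.mem_nhds ?_)).congr_of_eventuallyEq ?_
  · simp [chartZero]
  · exact Eventually.of_forall fun z => (chartZero_symm z).symm

theorem contMDiffAt_chartZero {x : OnePoint ℂ} (hx : x ≠ OnePoint.infty) :
    ContMDiffAt 𝓘(ℂ) 𝓘(ℂ) ω chartZero x :=
  contMDiffAt_of_mem_maximalAtlas chartZero_mem_maximalAtlas (mem_chartZero_source.2 hx)

theorem inv_ne_infty {x : OnePoint ℂ} : inv x ≠ OnePoint.infty ↔ x ≠ ((0 : ℂ) : OnePoint ℂ) := by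
  rw [← inv_zero]
  exact (Function.LeftInverse.injective inv_inv).ne_iff

theorem contMDiff_inv : ContMDiff 𝓘(ℂ) 𝓘(ℂ) ω inv := by
  intro x
  by_cases hx : x = ((0 : ℂ) : OnePoint ℂ)
  · subst hx
    -- near `0`, inversion is the inverse of the chart at infinity, read in the affine chart
    have h1 := contMDiffOn_symm_of_mem_maximalAtlas chartInfty_mem_maximalAtlas
    have h2 : ContMDiffAt 𝓘(ℂ) 𝓘(ℂ) ω chartInfty.symm (chartZero ((0 : ℂ) : OnePoint ℂ)) :=
      h1.contMDiffAt (chartInfty.open_target.mem_nhds (by simp [chartInfty, chartZero]))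
    refine (h2.comp _ (contMDiffAt_chartZero (OnePoint.coe_ne_infty 0))).congr_of_eventuallyEq ?_
    filter_upwards [isOpen_ne.mem_nhds (OnePoint.coe_ne_infty (0 : ℂ))] with y hy
    rw [Function.comp_apply, chartInfty_symm, coe_chartZero hy]
  · have h1 : x ∈ chartInfty.source := by
      simpa [chartInfty, mem_chartZero_source] using! inv_ne_infty.2 hx
    have h2 := contMDiffAt_of_mem_maximalAtlas chartInfty_mem_maximalAtlas h1
    refine ((contMDiff_coe _).comp _ h2).congr_of_eventuallyEq ?_
    filter_upwards [isOpen_ne.mem_nhds hx] with y hy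
    rw [Function.comp_apply, chartInfty_apply, coe_chartZero (inv_ne_infty.2 hy)]

/-- The inversion as an automorphism of the sphere. -/
def invAut : HolAut 𝓘(ℂ) (OnePoint ℂ) := ⟨invHomeo.toEquiv, contMDiff_inv, contMDiff_inv⟩

theorem coe_ne_zero_iff {z : ℂ} : (z : OnePoint ℂ) ≠ ((0 : ℂ) : OnePoint ℂ) ↔ z ≠ 0 :=
  OnePoint.coe_injective.ne_iff

theorem map_add_coe (c z : ℂ) :
    OnePoint.map (· + c) (z : OnePoint ℂ) = ((z + c : ℂ) : OnePoint ℂ) := rfl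

/-- In the coordinate `w = 1 / z` at infinity the translation reads `w / (1 + c * w)`, which is
holomorphic at `w = 0`. -/
theorem contMDiff_map_add (c : ℂ) :
    ContMDiff 𝓘(ℂ) 𝓘(ℂ) ω (OnePoint.map (· + c) : OnePoint ℂ → OnePoint ℂ) := by
  have key : ∀ w : ℂ, 1 + c * w ≠ 0 → OnePoint.map (· + c) (inv (w : OnePoint ℂ)) =
      inv ((w / (1 + c * w) : ℂ) : OnePoint ℂ) := by
    intro w hw
    by_cases h0 : w = 0
    · subst h0; simp [inv_zero]
    · rw [inv_coe h0, inv_coe (div_ne_zero h0 hw), map_add_coe]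
      congr 1
      field_simp
  intro x
  by_cases hx : x = OnePoint.infty
  · subst hx
    have hw : chartZero (inv OnePoint.infty) = 0 := by rw [inv_infty, chartZero_coe]
    have h0 : inv OnePoint.infty ≠ OnePoint.infty := by rw [inv_infty]; exact OnePoint.coe_ne_infty _
    have h1 : ContMDiffAt 𝓘(ℂ) 𝓘(ℂ) ω (fun x => chartZero (inv x)) OnePoint.infty :=
      ContMDiffAt.comp (g := chartZero) _ (contMDiffAt_chartZero h0) (contMDiff_inv _)
    have h2 : ContMDiffAt 𝓘(ℂ) 𝓘(ℂ) ω (fun w : ℂ => w / (1 + c * w))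
        (chartZero (inv OnePoint.infty)) := by
      rw [hw]
      refine ContDiffAt.contMDiffAt ?_
      exact contDiffAt_id.div (contDiffAt_const.add (contDiffAt_const.mul contDiffAt_id)) (by simp)
    have h3 := (contMDiff_inv _).comp _ ((contMDiff_coe _).comp _ (ContMDiffAt.comp
      (f := fun x => chartZero (inv x)) _ h2 h1))
    refine h3.congr_of_eventuallyEq ?_
    have h4 : ∀ᶠ x in 𝓝 OnePoint.infty, 1 + c * chartZero (inv x) ≠ 0 := by
      have : ContinuousAt (fun x => 1 + c * chartZero (inv x)) OnePoint.infty :=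
        continuousAt_const.add (continuousAt_const.mul h1.continuousAt)
      exact this.eventually_ne (by rw [hw]; simp)
    filter_upwards [h4, continuous_inv.continuousAt.eventually_ne h0] with x hx hx'
    simp only [Function.comp_apply]
    rw [← key _ hx, coe_chartZero hx', inv_inv]
  · have h2 : ContMDiffAt 𝓘(ℂ) 𝓘(ℂ) ω (fun w : ℂ => w + c) (chartZero x) :=
      (contDiffAt_id.add contDiffAt_const).contMDiffAt
    refine ((contMDiff_coe _).comp _ (h2.comp _ (contMDiffAt_chartZero hx))).congr_of_eventuallyEq ?_
    filter_upwards [isOpen_ne.mem_nhds hx] with y hy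
    simp only [Function.comp_apply]
    rw [← map_add_coe, coe_chartZero hy]

/-- Translations as automorphisms of the sphere. -/
def transAut (c : ℂ) : HolAut 𝓘(ℂ) (OnePoint ℂ) where
  val := 
    { toFun := OnePoint.map (· + c)
      invFun := OnePoint.map (· + -c)
      left_inv := fun x => by
        induction x using OnePoint.rec <;> simp
      right_inv := fun x => by
        induction x using OnePoint.rec <;> simp }
  property := ⟨contMDiff_map_add c, contMDiff_map_add (-c)⟩

theorem exists_aut_zero_eq (p : OnePoint ℂ) :
    ∃ m : HolAut 𝓘(ℂ) (OnePoint ℂ), m.1 ((0 : ℂ) : OnePoint ℂ) = p := by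
  induction p using OnePoint.rec with
  | infty => exact ⟨invAut, inv_zero⟩
  | coe c => exact ⟨transAut c, by simp [transAut]⟩

theorem exists_aut_infty_eq (p : OnePoint ℂ) :
    ∃ m : HolAut 𝓘(ℂ) (OnePoint ℂ), m.1 OnePoint.infty = p := by
  obtain ⟨m, hm⟩ := exists_aut_zero_eq p
  exact ⟨m * invAut, by rw [← hm, ← inv_infty]; rfl⟩

theorem tendsto_coe_cocompact :
    Tendsto ((↑) : ℂ → OnePoint ℂ) (cocompact ℂ) (𝓝 OnePoint.infty) := by
  rw [← coclosedCompact_eq_cocompact]; exact OnePoint.tendsto_coe_infty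

/-- A holomorphic self-map of the Riemann sphere has a fixed point. -/
theorem exists_fixedPoint {g : OnePoint ℂ → OnePoint ℂ} (hg : ContMDiff 𝓘(ℂ) 𝓘(ℂ) ω g) :
    ∃ x, g x = x := by
  by_contra! hfix
  classical
  -- `h` is `1 / (g z - z)`, with its limit `0` as value at the poles of `g`. It will be entire and
  -- tend to zero at infinity, so Liouville gives `h = 0`.
  let h : ℂ → ℂ := fun z =>
    if g (z : OnePoint ℂ) = OnePoint.infty then 0 else (chartZero (g (z : OnePoint ℂ)) - z)⁻¹
  have hgc : ContMDiff 𝓘(ℂ) 𝓘(ℂ) ω (fun z : ℂ => g (z : OnePoint ℂ)) := hg.comp contMDiff_coe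
  have hdiff : Differentiable ℂ h := by
    intro z
    -- At a pole, write `u = 1 / g`; nearby `h = u / (1 - z * u)`, whose denominator is `1` at the
    -- pole.
    by_cases hz : g (z : OnePoint ℂ) = OnePoint.infty
    · have h0 : inv (g (z : OnePoint ℂ)) ≠ OnePoint.infty := by
        rw [hz, inv_infty]; exact OnePoint.coe_ne_infty _
      have h1 : ContMDiffAt 𝓘(ℂ) 𝓘(ℂ) ω (fun z : ℂ => chartZero (inv (g (z : OnePoint ℂ)))) z :=
        ContMDiffAt.comp (g := chartZero) _ (contMDiffAt_chartZero h0) ((contMDiff_inv _).comp _ (hgc z))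
      have h2 : DifferentiableAt ℂ (fun z : ℂ => chartZero (inv (g (z : OnePoint ℂ)))) z :=
        h1.contDiffAt.differentiableAt (by simp)
      have hu : chartZero (inv (g (z : OnePoint ℂ))) = 0 := by rw [hz, inv_infty, chartZero_coe]
      have hd : DifferentiableAt ℂ (fun z : ℂ => 1 - z * chartZero (inv (g (z : OnePoint ℂ)))) z :=
        (differentiableAt_const _).sub (differentiableAt_id.mul h2)
      have h3 : DifferentiableAt ℂ (fun z : ℂ => chartZero (inv (g (z : OnePoint ℂ))) /
          (1 - z * chartZero (inv (g (z : OnePoint ℂ))))) z :=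
        h2.div hd (by rw [hu]; simp)
      refine h3.congr_of_eventuallyEq ?_
      have e1 : ∀ᶠ w : ℂ in 𝓝 z, inv (g (w : OnePoint ℂ)) ≠ OnePoint.infty :=
        (continuous_inv.comp hgc.continuous).continuousAt.eventually_ne h0
      filter_upwards [e1] with w hw
      obtain ⟨u, hu⟩ : ∃ u : ℂ, inv (g (w : OnePoint ℂ)) = u := ⟨_, (coe_chartZero hw).symm⟩
      have hgu : g (w : OnePoint ℂ) = inv u := by rw [← hu, inv_inv]
      simp only [h]
      rw [hu, chartZero_coe, hgu]
      by_cases hu0 : u = 0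
      · subst hu0; simp [inv_zero]
      · rw [inv_coe hu0, if_neg (OnePoint.coe_ne_infty _), chartZero_coe]
        rw [← one_div_one_div (u⁻¹ - w), one_div (u⁻¹ - w)]
        field_simp
    · have h1 : ContMDiffAt 𝓘(ℂ) 𝓘(ℂ) ω (fun z : ℂ => chartZero (g (z : OnePoint ℂ))) z :=
        ContMDiffAt.comp (g := chartZero) _ (contMDiffAt_chartZero hz) (hgc z)
      have h2 : DifferentiableAt ℂ (fun z : ℂ => chartZero (g (z : OnePoint ℂ))) z :=
        h1.contDiffAt.differentiableAt (by simp)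
      have h3 : chartZero (g (z : OnePoint ℂ)) - z ≠ 0 := by
        intro h0
        refine hfix z ?_
        rw [← coe_chartZero hz, sub_eq_zero.1 h0]
      refine ((h2.sub differentiableAt_id).inv h3).congr_of_eventuallyEq ?_
      filter_upwards [hgc.continuous.continuousAt.eventually_ne hz] with w hw
      simp [h, hw]
  have hlim : Tendsto h (cocompact ℂ) (𝓝 0) := by
    have hinf := hfix OnePoint.infty
    have h1 : Tendsto (fun z : ℂ => g (z : OnePoint ℂ)) (cocompact ℂ) (𝓝 (g OnePoint.infty)) :=
      (hg.continuous.tendsto _).comp tendsto_coe_cocompact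
    have h2 : Tendsto (fun z : ℂ => chartZero (g (z : OnePoint ℂ))) (cocompact ℂ)
        (𝓝 (chartZero (g OnePoint.infty))) :=
      (contMDiffAt_chartZero hinf).continuousAt.tendsto.comp h1
    have h3 : Tendsto (fun z : ℂ => chartZero (g (z : OnePoint ℂ)) - z) (cocompact ℂ)
        (Bornology.cobounded ℂ) := by
      rw [← Metric.cobounded_eq_cocompact] at h2 ⊢
      rw [← tendsto_norm_atTop_iff_cobounded]
      have h4 : Tendsto (fun z : ℂ => ‖z‖ + -‖chartZero (g (z : OnePoint ℂ))‖)
          (Bornology.cobounded ℂ) atTop :=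
        tendsto_norm_cobounded_atTop.atTop_add h2.norm.neg
      refine tendsto_atTop_mono (fun z => ?_) h4
      rw [← sub_eq_add_neg, norm_sub_rev]
      exact norm_sub_norm_le _ _
    refine (tendsto_inv₀_cobounded.comp h3).congr' ?_
    filter_upwards [h1.eventually_ne hinf] with z hz
    simp [h, hz]
  -- Away from poles `h` is the inverse of a nonzero number, so its vanishing leaves only poles.
  -- Then `g` is `∞` on `ℂ` and, by continuity, also at `∞`, a fixed point after all.
  have hzero : ∀ z, g ((z : ℂ) : OnePoint ℂ) = OnePoint.infty := by
    intro z
    by_contra hz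
    have h0 : h z = 0 := hdiff.apply_eq_of_tendsto_cocompact z hlim
    simp only [h, if_neg hz, inv_eq_zero] at h0
    refine hfix z ?_
    rw [← coe_chartZero hz, sub_eq_zero.1 h0]
  refine hfix OnePoint.infty ?_
  have h1 : Tendsto (fun z : ℂ => g (z : OnePoint ℂ)) (cocompact ℂ) (𝓝 (g OnePoint.infty)) :=
    (hg.continuous.tendsto _).comp tendsto_coe_cocompact
  refine tendsto_nhds_unique h1 ?_
  simp only [hzero]
  exact tendsto_const_nhds

end RiemannSphere

/-! ### Automorphisms of powers of the Riemann sphere: Jacobians in the affine chart -/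

namespace PPow

open Filter RiemannSphere

variable {r : ℕ}

/-- Automorphisms of `(ℙ¹)^r`. -/
abbrev Aut (r : ℕ) : Subgroup (Equiv.Perm (PPow r)) := HolAut (modelPow r) (PPow r)

/-- The inclusion of the affine part `ℂ^r`. -/
def coePow (v : Fin r → ℂ) : PPow r := fun i => (v i : OnePoint ℂ)

/-- The points of the affine part. -/
def IsAffine (x : PPow r) : Prop := ∀ i, x i ≠ OnePoint.infty

/-- The affine coordinates. -/
def affine (x : PPow r) : Fin r → ℂ := fun i => chartZero (x i)

theorem isAffine_coePow (v : Fin r → ℂ) : IsAffine (coePow v) := fun _ => OnePoint.coe_ne_infty _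

theorem affine_coePow (v : Fin r → ℂ) : affine (coePow v) = v := funext fun _ => chartZero_coe _

theorem coePow_affine {x : PPow r} (hx : IsAffine x) : coePow (affine x) = x :=
  funext fun i => coe_chartZero (hx i)

theorem isOpen_isAffine : IsOpen {x : PPow r | IsAffine x} := by
  simp only [IsAffine, Set.ofPred_forall]
  exact isOpen_iInter_of_finite fun i => isOpen_ne.preimage (continuous_apply i)

theorem contMDiff_coePow : ContMDiff 𝓘(ℂ, Fin r → ℂ) (modelPow r) ω (coePow (r := r)) :=
  contMDiff_pi_iff.2 fun i => contMDiff_coe.comp (contDiff_apply ℂ ℂ i).contMDiff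

theorem contMDiffAt_affine {x : PPow r} (hx : IsAffine x) :
    ContMDiffAt (modelPow r) 𝓘(ℂ, Fin r → ℂ) ω affine x :=
  contMDiffAt_pi_space.2 fun i =>
    ContMDiffAt.comp (g := chartZero) _ (contMDiffAt_chartZero (hx i)) (contMDiff_pi_apply i x)

/-- An automorphism in affine coordinates. -/
def loc (F : Aut r) (v : Fin r → ℂ) : Fin r → ℂ := affine (F.1 (coePow v))

theorem contDiffAt_loc {F : Aut r} {v : Fin r → ℂ} (h : IsAffine (F.1 (coePow v))) :
    ContDiffAt ℂ ω (loc F) v :=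
  ((contMDiffAt_affine h).comp v ((F.2.1 _).comp v (contMDiff_coePow v))).contDiffAt

theorem eventually_isAffine {F : Aut r} {v : Fin r → ℂ} (h : IsAffine (F.1 (coePow v))) :
    ∀ᶠ w in 𝓝 v, IsAffine (F.1 (coePow w)) :=
  (F.2.1.continuous.comp contMDiff_coePow.continuous).continuousAt.eventually_mem
    (isOpen_isAffine.mem_nhds h)

theorem coePow_loc {F : Aut r} {v : Fin r → ℂ} (h : IsAffine (F.1 (coePow v))) :
    coePow (loc F v) = F.1 (coePow v) := coePow_affine h

/-- The Jacobian determinant in affine coordinates. -/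
def jac (F : Aut r) (v : Fin r → ℂ) : ℂ := (fderiv ℂ (loc F) v).det

theorem jac_mul {A F : Aut r} {v : Fin r → ℂ} (hF : IsAffine (F.1 (coePow v)))
    (hA : IsAffine (A.1 (F.1 (coePow v)))) : jac (A * F) v = jac A (loc F v) * jac F v := by
  have h1 : loc (A * F) =ᶠ[𝓝 v] loc A ∘ loc F := by
    filter_upwards [eventually_isAffine hF] with w hw
    simp only [loc, Function.comp_apply]
    rw [coePow_affine hw]; rfl
  have h2 : IsAffine (A.1 (coePow (loc F v))) := by rwa [coePow_loc hF]
  rw [jac, h1.fderiv_eq, fderiv_comp _ ((contDiffAt_loc h2).differentiableAt (by simp))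
    ((contDiffAt_loc hF).differentiableAt (by simp))]
  exact LinearMap.det_comp _ _

theorem jac_one (v : Fin r → ℂ) : jac (1 : Aut r) v = 1 := by
  have : loc (1 : Aut r) = id := funext affine_coePow
  rw [jac, this, fderiv_id]
  exact LinearMap.det_id

theorem jac_ne_zero {F : Aut r} {v : Fin r → ℂ} (h : IsAffine (F.1 (coePow v))) : jac F v ≠ 0 := by
  have e : F⁻¹.1 (F.1 (coePow v)) = coePow v := F.1.symm_apply_apply _
  have h1 := jac_mul h (A := F⁻¹) (by rw [e]; exact isAffine_coePow v)
  rw [inv_mul_cancel, jac_one] at h1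
  exact right_ne_zero_of_mul (h1 ▸ one_ne_zero)

/-- The determinant is a polynomial in the partial derivatives, by the Leibniz formula. -/
theorem differentiableAt_jac {F : Aut r} {v : Fin r → ℂ} (h : IsAffine (F.1 (coePow v))) :
    DifferentiableAt ℂ (jac F) v := by
  have h1 : DifferentiableAt ℂ (fderiv ℂ (loc F)) v :=
    ((contDiffAt_loc h).fderiv_right (m := 1) (by simp)).differentiableAt (by simp)
  have h2 : jac F = fun w => ∑ σ : Equiv.Perm (Fin r), ((Equiv.Perm.sign σ : ℤ) : ℂ) *
      ∏ i, fderiv ℂ (loc F) w (Pi.single i 1) (σ i) := by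
    ext w
    rw [jac, ContinuousLinearMap.det, ← LinearMap.det_toMatrix', Matrix.det_apply']
    simp [LinearMap.toMatrix'_apply]
  rw [h2]
  refine DifferentiableAt.fun_sum fun σ _ => (differentiableAt_const _).fun_mul ?_
  have h3 : ∀ i ∈ Finset.univ, DifferentiableAt ℂ
      (fun w => fderiv ℂ (loc F) w (Pi.single i 1) (σ i)) v := fun i _ =>
    differentiableAt_pi.1 (h1.clm_apply (differentiableAt_const _)) _
  exact (HasFDerivAt.finsetProd fun i hi => (h3 i hi).hasFDerivAt).differentiableAt

/-- Products of automorphisms of the sphere. -/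
def prodAut (m : Fin r → HolAut 𝓘(ℂ) (OnePoint ℂ)) : Aut r :=
  ⟨Equiv.piCongrRight fun i => (m i).1,
    contMDiff_pi_iff.2 fun i => (m i).2.1.comp (contMDiff_pi_apply i),
    contMDiff_pi_iff.2 fun i => (m i).2.2.comp (contMDiff_pi_apply i)⟩

theorem prodAut_apply (m : Fin r → HolAut 𝓘(ℂ) (OnePoint ℂ)) (x : PPow r) (i : Fin r) :
    (prodAut m).1 x i = (m i).1 (x i) := rfl

/-- Inversion of the coordinates in `T`. -/
def invOn (T : Finset (Fin r)) : Aut r := prodAut fun i => if i ∈ T then invAut else 1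

theorem invOn_apply_of_mem {T : Finset (Fin r)} {i : Fin r} (hi : i ∈ T) (x : PPow r) :
    (invOn T).1 x i = inv (x i) := by
  rw [invOn, prodAut_apply, if_pos hi]; rfl

theorem invOn_apply_of_notMem {T : Finset (Fin r)} {i : Fin r} (hi : i ∉ T) (x : PPow r) :
    (invOn T).1 x i = x i := by
  rw [invOn, prodAut_apply, if_neg hi]; rfl

theorem invOn_mul_self (T : Finset (Fin r)) : invOn T * invOn T = 1 := by
  refine Subtype.ext (Equiv.ext fun x => funext fun i => ?_)
  change (invOn T).1 ((invOn T).1 x) i = x i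
  by_cases hi : i ∈ T
  · rw [invOn_apply_of_mem hi, invOn_apply_of_mem hi, inv_inv]
  · rw [invOn_apply_of_notMem hi, invOn_apply_of_notMem hi]

theorem isAffine_invOn {T : Finset (Fin r)} {v : Fin r → ℂ} (hv : ∀ i ∈ T, v i ≠ 0) :
    IsAffine ((invOn T).1 (coePow v)) := by
  intro i
  by_cases hi : i ∈ T
  · rw [invOn_apply_of_mem hi]
    exact inv_ne_infty.2 (coe_ne_zero_iff.2 (hv i hi))
  · rw [invOn_apply_of_notMem hi]
    exact OnePoint.coe_ne_infty _

theorem jac_invOn {T : Finset (Fin r)} {v : Fin r → ℂ} (hv : ∀ i ∈ T, v i ≠ 0) :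
    jac (invOn T) v = ∏ i ∈ T, -(v i ^ 2)⁻¹ := by
  let c : Fin r → ℂ := fun i => if i ∈ T then -(v i ^ 2)⁻¹ else 1
  have h1 : HasFDerivAt (loc (invOn T))
      (ContinuousLinearMap.pi fun i => c i • ContinuousLinearMap.proj (R := ℂ) (φ := fun _ => ℂ) i)
      v := by
    rw [hasFDerivAt_pi]
    intro i
    have hp : HasFDerivAt (fun w : Fin r → ℂ => w i)
        (ContinuousLinearMap.proj (R := ℂ) (φ := fun _ => ℂ) i) v := hasFDerivAt_apply i v
    by_cases hi : i ∈ T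
    · have h2 := (hasDerivAt_inv (hv i hi)).comp_hasFDerivAt v hp
      simp only [c, if_pos hi]
      refine h2.congr_of_eventuallyEq ?_
      have : ∀ᶠ w : Fin r → ℂ in 𝓝 v, w i ≠ 0 :=
        (continuous_apply i).continuousAt.eventually_ne (hv i hi)
      filter_upwards [this] with w hw
      simp only [loc, affine, Function.comp_apply]
      rw [invOn_apply_of_mem hi, coePow, inv_coe hw, chartZero_coe]
    · simp only [c, if_neg hi, one_smul]
      refine hp.congr_of_eventuallyEq (Eventually.of_forall fun w => ?_)
      simp only [loc, affine]
      rw [invOn_apply_of_notMem hi, coePow, chartZero_coe]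
  rw [jac, h1.fderiv]
  have h3 : ((ContinuousLinearMap.pi fun i => c i •
      ContinuousLinearMap.proj (R := ℂ) (φ := fun _ => ℂ) i : (Fin r → ℂ) →L[ℂ] (Fin r → ℂ)) :
      (Fin r → ℂ) →ₗ[ℂ] (Fin r → ℂ)) = Matrix.toLin' (Matrix.diagonal c) := by
    ext w i
    by_cases h : i = w <;> simp [h]
  rw [ContinuousLinearMap.det, h3, LinearMap.det_toLin', Matrix.det_diagonal]
  simp [c, Finset.prod_ite_mem]

open Classical in
/-- The inverse of the Jacobian determinant, extended by zero. -/
def jacInv (F : Aut r) (v : Fin r → ℂ) : ℂ := if IsAffine (F.1 (coePow v)) then (jac F v)⁻¹ else 0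

/-- The chain rule for `F = invOn T * E`, where `E = invOn T * F` is finite at `v`. The product on
the right vanishes exactly where some `F` component in `T` is infinite, which matches the value zero
in `jacInv`. -/
theorem jacInv_eq {F : Aut r} {v : Fin r → ℂ} {T : Finset (Fin r)}
    (h : IsAffine ((invOn T * F).1 (coePow v))) :
    jacInv F v = (∏ i ∈ T, -(loc (invOn T * F) v i ^ 2)) * (jac (invOn T * F) v)⁻¹ := by
  set E := invOn T * F
  have hF : F = invOn T * E := by rw [← mul_assoc, invOn_mul_self, one_mul]
  have hFv : F.1 (coePow v) = (invOn T).1 (coePow (loc E v)) := by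
    rw [coePow_loc h]
    exact congrArg (fun G : Aut r => G.1 (coePow v)) hF
  by_cases h0 : ∀ i ∈ T, loc E v i ≠ 0
  · have h1 := isAffine_invOn h0
    rw [jacInv, if_pos (by rwa [hFv])]
    conv_lhs => rw [hF]
    rw [jac_mul h (by rwa [coePow_loc h] at h1), jac_invOn h0, mul_inv, ← Finset.prod_inv_distrib]
    congr 1
    exact Finset.prod_congr rfl fun i _ => by rw [inv_neg, _root_.inv_inv]
  · push Not at h0
    obtain ⟨i, hi, h0⟩ := h0
    rw [jacInv, if_neg, Finset.prod_eq_zero hi (by simp [h0]), zero_mul]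
    intro h1
    refine h1 i ?_
    rw [hFv, invOn_apply_of_mem hi, coePow, h0, inv_zero]

theorem exists_isAffine_invOn_mul (F : Aut r) (x : PPow r) :
    ∃ T : Finset (Fin r), (∀ i, i ∈ T ↔ F.1 x i = OnePoint.infty) ∧
      IsAffine ((invOn T * F).1 x) := by
  classical
  refine ⟨Finset.univ.filter fun i => F.1 x i = OnePoint.infty, fun i => by simp, fun i => ?_⟩
  change (invOn _).1 (F.1 x) i ≠ _
  by_cases hi : F.1 x i = OnePoint.infty
  · rw [invOn_apply_of_mem (by simpa using hi), hi, inv_infty]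
    exact OnePoint.coe_ne_infty _
  · rwa [invOn_apply_of_notMem (by simpa using hi)]

theorem differentiableAt_loc_apply {F : Aut r} {v : Fin r → ℂ} (h : IsAffine (F.1 (coePow v)))
    (i : Fin r) : DifferentiableAt ℂ (fun w => loc F w i) v :=
  differentiableAt_pi.1 ((contDiffAt_loc h).differentiableAt (by simp)) i

/-- Near `v`, inverting the components that are infinite at `v` makes the formula of `jacInv_eq`
available, and its right-hand side is holomorphic there. -/
theorem differentiable_jacInv (F : Aut r) : Differentiable ℂ (jacInv F) := by
  intro v
  obtain ⟨T, -, hT⟩ := exists_isAffine_invOn_mul F (coePow v)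
  have h1 : DifferentiableAt ℂ (fun w => (∏ i ∈ T, -(loc (invOn T * F) w i ^ 2)) *
      (jac (invOn T * F) w)⁻¹) v := by
    refine DifferentiableAt.fun_mul ?_ ((differentiableAt_jac hT).inv (jac_ne_zero hT))
    have h1 : ∀ i ∈ T, DifferentiableAt ℂ (fun w => -(loc (invOn T * F) w i ^ 2)) v :=
      fun i _ => ((differentiableAt_loc_apply hT i).fun_pow 2).fun_neg
    exact (HasFDerivAt.finsetProd fun i hi => (h1 i hi).hasFDerivAt).differentiableAt
  refine h1.congr_of_eventuallyEq ?_
  filter_upwards [eventually_isAffine hT] with w hw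
  exact jacInv_eq hw

theorem coePow_single_inv {k : Fin r} {z : ℂ} (hz : z ≠ 0) :
    (invOn {k}).1 (coePow (Pi.single k z)) = coePow (Pi.single k z⁻¹) := by
  ext1 i
  by_cases hi : i = k
  · subst hi
    rw [invOn_apply_of_mem (Finset.mem_singleton_self _)]
    simp [coePow, inv_coe hz]
  · rw [invOn_apply_of_notMem (by simpa using hi)]
    simp [coePow, hi]

/-- The chain rule for the substitution `w = 1 / z` on the `k`-th line, which moves the study at
infinity to `w = 0`. -/
theorem jacInv_single {F : Aut r} {k : Fin r} {z : ℂ} (hz : z ≠ 0) :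
    jacInv F (Pi.single k z) = jacInv (F * invOn {k}) (Pi.single k z⁻¹) * -(z ^ 2) := by
  have hv : ∀ i ∈ ({k} : Finset (Fin r)), (Pi.single k z : Fin r → ℂ) i ≠ 0 := by simpa using hz
  have e : (F * invOn {k}).1 (coePow (Pi.single k z⁻¹)) = F.1 (coePow (Pi.single k z)) := by
    rw [← coePow_single_inv hz]
    change F.1 ((invOn {k} * invOn {k} : Aut r).1 _) = _
    rw [invOn_mul_self]; rfl
  have hl : loc (invOn {k}) (Pi.single k z) = Pi.single k z⁻¹ := by
    rw [loc, coePow_single_inv hz, affine_coePow]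
  by_cases h : IsAffine (F.1 (coePow (Pi.single k z)))
  · rw [jacInv, jacInv, if_pos h, if_pos (by rwa [e])]
    have hF : F = F * invOn {k} * invOn {k} := by rw [mul_assoc, invOn_mul_self, mul_one]
    conv_lhs => rw [hF]
    rw [jac_mul (isAffine_invOn hv) (by rwa [coePow_single_inv hz, e]), hl, jac_invOn hv]
    simp [mul_comm]
  · rw [jacInv, jacInv, if_neg h, if_neg (by rwa [e]), zero_mul]

theorem differentiable_single (k : Fin r) :
    Differentiable ℂ (fun z : ℂ => (Pi.single k z : Fin r → ℂ)) :=
  (ContinuousLinearMap.single ℂ (fun _ : Fin r => ℂ) k).differentiable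

/-- If two components of an automorphism have a pole at the infinite point of a coordinate line,
then the inverse Jacobian vanishes at infinity along this line. -/
theorem tendsto_jacInv_single {F : Aut r} {k i j : Fin r} (hij : i ≠ j)
    (hi : F.1 (Function.update (coePow 0) k OnePoint.infty) i = OnePoint.infty)
    (hj : F.1 (Function.update (coePow 0) k OnePoint.infty) j = OnePoint.infty) :
    Tendsto (fun z : ℂ => jacInv F (Pi.single k z)) (Bornology.cobounded ℂ) (𝓝 0) := by
  have hP : (invOn {k}).1 (coePow (Pi.single k 0)) =
      Function.update (coePow 0) k OnePoint.infty := by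
    ext1 l
    by_cases hl : l = k
    · subst hl
      rw [invOn_apply_of_mem (Finset.mem_singleton_self _)]
      simp [coePow, inv_zero]
    · rw [invOn_apply_of_notMem (by simpa using hl)]
      simp [coePow, hl]
  set F' := F * invOn {k}
  have hF' : F'.1 (coePow (Pi.single k 0)) = F.1 (Function.update (coePow 0) k OnePoint.infty) :=
    congrArg F.1 hP
  obtain ⟨T, hmem, hT⟩ := exists_isAffine_invOn_mul F' (coePow (Pi.single k 0))
  rw [hF'] at hmem
  have hiT : i ∈ T := (hmem i).2 hi
  have hjT : j ∈ T.erase i := Finset.mem_erase.2 ⟨hij.symm, (hmem j).2 hj⟩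
  set E := invOn T * F'
  have hzero : ∀ l ∈ T, loc E (Pi.single k 0) l = 0 := by
    intro l hl
    change chartZero ((invOn T).1 (F'.1 (coePow (Pi.single k 0))) l) = 0
    rw [invOn_apply_of_mem hl, hF', (hmem l).1 hl, inv_infty, chartZero_coe]
  have hs : DifferentiableAt ℂ (fun z : ℂ => (Pi.single k z : Fin r → ℂ)) 0 :=
    differentiable_single k 0
  have hloc : ∀ l, DifferentiableAt ℂ (fun w : ℂ => loc E (Pi.single k w) l) 0 := fun l =>
    (differentiableAt_loc_apply hT l).comp (0 : ℂ) hs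
  have hjac : DifferentiableAt ℂ (fun w : ℂ => (jac E (Pi.single k w))⁻¹) 0 :=
    ((differentiableAt_jac hT).comp (0 : ℂ) hs).inv (jac_ne_zero hT)
  have hev : ∀ᶠ w : ℂ in 𝓝 0, IsAffine (E.1 (coePow (Pi.single k w))) :=
    hs.continuousAt.eventually (eventually_isAffine hT)
  -- The square of component `i` of `E` is split off, to be divided by `w ^ 2`. The remainder still
  -- contains the factor of `j`, which vanishes at `w = 0`.
  let rest : ℂ → ℂ := fun w =>
    (∏ l ∈ T.erase i, -(loc E (Pi.single k w) l ^ 2)) * (jac E (Pi.single k w))⁻¹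
  have hrest : Tendsto rest (𝓝[≠] 0) (𝓝 0) := by
    have h1 : DifferentiableAt ℂ rest 0 :=
      (DifferentiableAt.fun_finsetProd fun l _ => ((hloc l).fun_pow 2).fun_neg).fun_mul hjac
    have h2 : rest 0 = 0 := by
      simp only [rest]
      rw [Finset.prod_eq_zero hjT (by
        rw [hzero j (Finset.mem_of_mem_erase hjT)]; simp), zero_mul]
    have h3 := h1.continuousAt.tendsto
    rw [h2] at h3
    exact h3.mono_left nhdsWithin_le_nhds
  have hslope : Tendsto (fun w : ℂ => (w⁻¹ * loc E (Pi.single k w) i) ^ 2) (𝓝[≠] 0)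
      (𝓝 (deriv (fun w : ℂ => loc E (Pi.single k w) i) 0 ^ 2)) := by
    have h1 := (hasDerivAt_iff_tendsto_slope.1 (hloc i).hasDerivAt).pow 2
    refine h1.congr fun w => ?_
    rw [slope_def_field, hzero i hiT, sub_zero, sub_zero, div_eq_inv_mul]
  -- The factor `w⁻¹ ^ 2` from the change of variable is absorbed by the zero of component `i`,
  -- leaving a squared difference quotient with finite limit; the factor of `j` then forces the
  -- limit zero.
  have hmain : Tendsto (fun w : ℂ => jacInv F' (Pi.single k w) * -(w⁻¹ ^ 2)) (𝓝[≠] 0) (𝓝 0) := by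
    have h1 := hslope.mul hrest
    rw [mul_zero] at h1
    refine h1.congr' ?_
    filter_upwards [nhdsWithin_le_nhds hev] with w hw
    rw [jacInv_eq hw, ← Finset.mul_prod_erase T _ hiT]
    simp only [rest]
    ring
  refine (hmain.comp tendsto_inv₀_cobounded').congr' ?_
  have : ∀ᶠ z : ℂ in Bornology.cobounded ℂ, z ≠ 0 :=
    Bornology.eventually_ne_cobounded 0
  filter_upwards [this] with z hz
  simp only [Function.comp_apply]
  rw [jacInv_single hz, _root_.inv_inv]

/-- By Liouville the inverse Jacobian vanishes identically on the line, whereas it is nonzero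
wherever the image is affine. -/
theorem not_isAffine_of_two_poles {F : Aut r} {k i j : Fin r} (hij : i ≠ j)
    (hi : F.1 (Function.update (coePow 0) k OnePoint.infty) i = OnePoint.infty)
    (hj : F.1 (Function.update (coePow 0) k OnePoint.infty) j = OnePoint.infty) (z : ℂ) :
    ¬ IsAffine (F.1 (coePow (Pi.single k z))) := by
  intro h
  have h1 := tendsto_jacInv_single hij hi hj
  rw [Metric.cobounded_eq_cocompact] at h1
  have h2 := ((differentiable_jacInv F).comp (differentiable_single k)).apply_eq_of_tendsto_cocompact
    z h1
  rw [Function.comp_apply, jacInv, if_pos h] at h2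
  exact inv_ne_zero (jac_ne_zero h) h2

theorem exists_common_separated {X Y Z : Type*} {f : X → Y} {g : X → Z}
    (hf : ∃ x y, f x ≠ f y) (hg : ∃ x y, g x ≠ g y) : ∃ x y, f x ≠ f y ∧ g x ≠ g y := by
  obtain ⟨a, b, hab⟩ := hf
  obtain ⟨c, hc⟩ : ∃ c, g c ≠ g a := by
    by_contra! h
    obtain ⟨x, y, hxy⟩ := hg
    exact hxy ((h x).trans (h y).symm)
  by_cases h1 : g a = g b
  · by_cases h2 : f c = f a
    · exact ⟨c, b, by rwa [h2], by rwa [← h1]⟩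
    · exact ⟨c, a, h2, hc⟩
  · exact ⟨a, b, hab, h1⟩

/-- Along a coordinate line, at most one component of an automorphism of `(ℙ¹)^r` varies. -/
theorem eq_of_nonconstant_on_line (F : Aut r) (a : PPow r) {k i j : Fin r}
    (hi : ∃ x y, F.1 (Function.update a k x) i ≠ F.1 (Function.update a k y) i)
    (hj : ∃ x y, F.1 (Function.update a k x) j ≠ F.1 (Function.update a k y) j) : i = j := by
  by_contra hij
  obtain ⟨P, Q, hPi, hPj⟩ := exists_common_separated
    (f := fun x => F.1 (Function.update a k x) i) (g := fun x => F.1 (Function.update a k x) j) hi hj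
  -- Coordinates on the source: the `k`-th axis through the origin goes to the given line, with `∞`
  -- going to `P`.
  have hN : ∀ l, ∃ m : HolAut 𝓘(ℂ) (OnePoint ℂ),
      (l ≠ k → m.1 ((0 : ℂ) : OnePoint ℂ) = a l) ∧ (l = k → m.1 OnePoint.infty = P) := by
    intro l
    by_cases hl : l = k
    · obtain ⟨m, hm⟩ := exists_aut_infty_eq P
      exact ⟨m, fun h => absurd hl h, fun _ => hm⟩
    · obtain ⟨m, hm⟩ := exists_aut_zero_eq (a l)
      exact ⟨m, fun _ => hm, fun h => absurd h hl⟩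
  choose n hn0 hninf using hN
  -- Coordinates on the target: components `i` and `j` become infinite at `P`, while every component
  -- is finite at `Q`.
  have hM : ∀ l, ∃ m : HolAut 𝓘(ℂ) (OnePoint ℂ),
      ((l = i ∨ l = j) → m.1 (F.1 (Function.update a k P) l) = OnePoint.infty) ∧
      m.1 (F.1 (Function.update a k Q) l) ≠ OnePoint.infty := by
    intro l
    by_cases hl : l = i ∨ l = j
    · obtain ⟨m, hm⟩ := exists_aut_infty_eq (F.1 (Function.update a k P) l)
      have h1 : m⁻¹.1 (F.1 (Function.update a k P) l) = OnePoint.infty := by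
        rw [← hm]; exact m.1.symm_apply_apply _
      refine ⟨m⁻¹, fun _ => h1, ?_⟩
      rw [← h1, m⁻¹.1.injective.ne_iff]
      rcases hl with rfl | rfl
      exacts [hPi.symm, hPj.symm]
    · obtain ⟨m, hm⟩ := exists_aut_zero_eq (F.1 (Function.update a k Q) l)
      have h1 : m⁻¹.1 (F.1 (Function.update a k Q) l) = ((0 : ℂ) : OnePoint ℂ) := by
        rw [← hm]; exact m.1.symm_apply_apply _
      exact ⟨m⁻¹, fun h => absurd h hl, by rw [h1]; exact OnePoint.coe_ne_infty _⟩
  choose m hminf hmfin using hM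
  set N := prodAut n
  set F' : Aut r := prodAut m * F * N
  have hNP : N.1 (Function.update (coePow 0) k OnePoint.infty) = Function.update a k P := by
    ext1 l
    rw [prodAut_apply]
    by_cases hl : l = k
    · subst hl; simpa using hninf l rfl
    · simpa [hl, coePow] using hn0 l hl
  have hF' : ∀ x l, F'.1 x l = (m l).1 (F.1 (N.1 x) l) := fun x l => rfl
  obtain ⟨z, hz⟩ : ∃ z : ℂ, (n k).1 (z : OnePoint ℂ) = Q := by
    obtain ⟨w, hw⟩ := (n k).1.surjective Q
    have hw' : w ≠ OnePoint.infty := by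
      rintro rfl
      rw [hninf k rfl] at hw
      exact hPi (by rw [hw])
    exact ⟨chartZero w, by rwa [coe_chartZero hw']⟩
  have hNQ : N.1 (coePow (Pi.single k z)) = Function.update a k Q := by
    ext1 l
    rw [prodAut_apply]
    by_cases hl : l = k
    · subst hl; simpa [coePow] using hz
    · simpa [hl, coePow] using hn0 l hl
  refine not_isAffine_of_two_poles (F := F') (k := k) hij ?_ ?_ z fun l => ?_
  · rw [hF', hNP, hminf i (Or.inl rfl)]
  · rw [hF', hNP, hminf j (Or.inr rfl)]
  · rw [hF', hNQ]
    exact hmfin l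

end PPow

/-! ### Automorphisms of powers of the Riemann sphere have fixed points -/

/-- Change the coordinates outside `S` one at a time. -/
theorem apply_eq_of_forall_update_eq {ι : Type*} [Fintype ι] [DecidableEq ι] {X Y : Type*}
    {f : (ι → X) → Y} {S : Set ι} (hf : ∀ k ∉ S, ∀ a x, f (Function.update a k x) = f a)
    {a b : ι → X} (hab : ∀ k ∈ S, a k = b k) : f a = f b := by
  classical
  have key : ∀ T : Finset ι, (∀ k ∈ T, k ∉ S) → f (T.piecewise b a) = f a := by
    intro T
    induction T using Finset.induction_on with
    | empty => intro _; rw [Finset.piecewise_empty]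
    | insert k T hk ih =>
      intro hT
      rw [Finset.piecewise_insert, hf k (hT k (Finset.mem_insert_self k T))]
      exact ih fun l hl => hT l (Finset.mem_insert_of_mem hl)
  rw [← key (Finset.univ.filter fun k => k ∉ S) (by simp)]
  congr 1
  ext k
  by_cases hk : k ∈ S
  · simp [Finset.piecewise, hk, hab k hk]
  · simp [Finset.piecewise, hk]

/-- If all maps with the property `P` have fixed points and `P` is stable under composition, then
maps of products that permute the factors, with components satisfying `P`, have fixed points. -/
theorem exists_fixedPoint_of_perm {ι X : Type*} [Finite ι] {P : (X → X) → Prop} (hid : P id)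
    (hcomp : ∀ f g, P f → P g → P (f ∘ g)) (hfix : ∀ f, P f → ∃ x, f x = x)
    (τ : Equiv.Perm ι) (g : ι → X → X) (hg : ∀ i, P (g i)) :
    ∃ x : ι → X, ∀ i, g i (x (τ i)) = x i := by
  classical
  -- `G n i` is the composite `g i ∘ g (τ i) ∘ ⋯` of `n` maps along the cycle of `i`.
  let G : ℕ → ι → X → X := fun n => n.rec (fun _ => id) fun _ G i => g i ∘ G (τ i)
  have hGs : ∀ n i, G (n + 1) i = g i ∘ G n (τ i) := fun _ _ => rfl
  have hG : ∀ n i, P (G n i) := by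
    intro n
    induction n with
    | zero => exact fun _ => hid
    | succ n ih => exact fun i => hcomp _ _ (hg i) (ih (τ i))
  let s := Equiv.Perm.SameCycle.setoid τ
  let rep : ι → ι := fun i => (Quotient.mk s i).out
  have hrep : ∀ i, rep (τ i) = rep i := by
    intro i
    have : Quotient.mk s (τ i) = Quotient.mk s i :=
      Quotient.sound (Equiv.Perm.sameCycle_apply_left.2 (Equiv.Perm.SameCycle.refl τ i))
    simp only [rep, this]
  have hex : ∀ i, ∃ m : ℕ, (τ ^ m) i = rep i := fun i => by
    have h : Equiv.Perm.SameCycle τ i (rep i) :=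
      (Quotient.exact (Quotient.out_eq (Quotient.mk s i)) : Equiv.Perm.SameCycle τ _ _).symm
    obtain ⟨m, -, hm⟩ := h.exists_pow_eq'
    exact ⟨m, hm⟩
  -- The least number of steps from `i` to the representative of its cycle. If `i` is itself the
  -- representative, then `m (τ i) + 1` is the length of the cycle, so `p i` below is fixed by the
  -- composite once around; the other values of `p` are not used.
  let m : ι → ℕ := fun i => Nat.find (hex i)
  choose p hp using fun i => hfix _ (hG (m (τ i) + 1) i)
  refine ⟨fun i => G (m i) i (p (rep i)), fun i => ?_⟩
  have hstep : g i (G (m (τ i)) (τ i) (p (rep (τ i)))) = G (m (τ i) + 1) i (p (rep i)) := by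
    rw [hrep, hGs]; rfl
  simp only [hstep]
  by_cases h0 : m i = 0
  · have hi : i = rep i := by
      have := Nat.find_spec (hex i)
      rw [show Nat.find (hex i) = 0 from h0] at this
      simpa using this
    rw [h0, ← hi]
    exact hp i
  · obtain ⟨n, hn⟩ := Nat.exists_eq_succ_of_ne_zero h0
    have hspec : (τ ^ m i) i = rep i := Nat.find_spec (hex i)
    have h1 : m (τ i) = n := by
      refine (Nat.find_eq_iff (hex (τ i))).2 ⟨?_, fun l hl hl' => ?_⟩
      · rw [hrep, ← hspec, hn, Nat.succ_eq_add_one, pow_succ]; rfl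
      · refine Nat.find_min (hex i) (m := l + 1) (by change _ < m i; omega) ?_
        rw [← hrep, ← hl', pow_succ]; rfl
    rw [h1, hn]

/-! ### Permutation of the factors and fixed points -/

namespace PPow

open RiemannSphere

variable {r : ℕ}

theorem exists_nonconstant_on_line (F : Aut r) (a : PPow r) (k : Fin r) :
    ∃ i, ∃ x y, F.1 (Function.update a k x) i ≠ F.1 (Function.update a k y) i := by
  by_contra! h
  have h1 : F.1 (Function.update a k OnePoint.infty) =
      F.1 (Function.update a k ((0 : ℂ) : OnePoint ℂ)) := funext fun i => h i _ _
  exact OnePoint.infty_ne_coe (0 : ℂ) (Function.update_injective a k (F.1.injective h1))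

/-- For every coordinate direction, the same component of an automorphism varies along all
coordinate lines of this direction. -/
theorem exists_unique_component (F : Aut r) (k : Fin r) :
    ∃ i, ∀ j, j ≠ i → ∀ (a : PPow r) (x : OnePoint ℂ), F.1 (Function.update a k x) j = F.1 a j := by
  let A : Fin r → Set (PPow r) := fun i =>
    {a | ∀ x y, F.1 (Function.update a k x) i = F.1 (Function.update a k y) i}
  have hA : ∀ i, IsClosed (A i) := by
    intro i
    have hc : ∀ x, Continuous fun a : PPow r => F.1 (Function.update a k x) i := fun x =>
      (continuous_apply i).comp (F.2.1.continuous.comp (continuous_id.update k continuous_const))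
    simp only [A, Set.ofPred_forall]
    exact isClosed_iInter fun x => isClosed_iInter fun y => isClosed_eq (hc x) (hc y)
  -- Exactly one component varies along each line, so non-constancy of component `i` amounts to
  -- constancy of all others, a closed condition. Hence `A i` is clopen in a connected space.
  have hB : ∀ i, (A i)ᶜ = ⋂ j, ⋂ _ : j ≠ i, A j := by
    intro i
    ext a
    simp only [Set.mem_compl_iff, Set.mem_iInter, A, Set.mem_ofPred_eq]
    constructor
    · intro h j hj x y
      push Not at h
      by_contra hxy
      exact hj (eq_of_nonconstant_on_line F a ⟨x, y, hxy⟩ h)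
    · intro h hi
      obtain ⟨l, x, y, hxy⟩ := exists_nonconstant_on_line F a k
      by_cases hl : l = i
      · subst hl; exact hxy (hi x y)
      · exact hxy (h l hl x y)
  have hclopen : ∀ i, IsClopen (A i) := fun i => ⟨hA i, by
    rw [← isClosed_compl_iff, hB]
    exact isClosed_iInter fun j => isClosed_iInter fun _ => hA j⟩
  obtain ⟨i, x, y, hxy⟩ := exists_nonconstant_on_line F (fun _ => OnePoint.infty) k
  refine ⟨i, fun j hj a z => ?_⟩
  have hi : A i = ∅ := by
    refine (isClopen_iff.1 (hclopen i)).resolve_right fun h => hxy ?_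
    have : (fun _ => OnePoint.infty : PPow r) ∈ A i := h ▸ Set.mem_univ _
    exact this x y
  have hj' : a ∈ A j := by
    have : a ∈ (A i)ᶜ := by rw [hi]; exact Set.notMem_empty a
    rw [hB] at this
    exact Set.mem_iInter₂.1 this j hj
  simpa using hj' z (a k)

/-- Automorphisms of `(ℙ¹)^r` permute the factors. -/
theorem exists_perm (F : Aut r) : ∃ τ : Equiv.Perm (Fin r), ∀ i (x y : PPow r),
    x (τ i) = y (τ i) → F.1 x i = F.1 y i := by
  choose σ hσ using exists_unique_component F
  have hdep : ∀ i (x y : PPow r), (∀ k, σ k = i → x k = y k) → F.1 x i = F.1 y i := by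
    intro i x y hxy
    exact apply_eq_of_forall_update_eq (f := fun a => F.1 a i) (S := {k | σ k = i})
      (fun k hk a x => hσ k i (fun h => hk h.symm) a x) hxy
  -- A component outside the range of `σ` would depend on no coordinate, contradicting surjectivity
  -- of `F`.
  have hsurj : Function.Surjective σ := by
    intro i
    by_contra! h
    obtain ⟨x, hx⟩ := F.1.surjective fun _ => OnePoint.infty
    obtain ⟨y, hy⟩ := F.1.surjective fun _ => ((0 : ℂ) : OnePoint ℂ)
    have := hdep i x y fun k hk => absurd hk (h k)
    rw [hx, hy] at this
    exact OnePoint.infty_ne_coe (0 : ℂ) this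
  have hinj := Finite.injective_iff_surjective.2 hsurj
  refine ⟨(Equiv.ofBijective σ ⟨hinj, hsurj⟩).symm, fun i x y hxy => hdep i x y fun k hk => ?_⟩
  have : (Equiv.ofBijective σ ⟨hinj, hsurj⟩).symm i = k := by
    rw [Equiv.symm_apply_eq]; exact hk.symm
  rwa [this] at hxy

/-- Every automorphism of `(ℙ¹)^r` has a fixed point. -/
theorem exists_fixedPoint (F : Aut r) : ∃ x, F.1 x = x := by
  obtain ⟨τ, hτ⟩ := exists_perm F
  obtain ⟨x, hx⟩ := exists_fixedPoint_of_perm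
    (P := fun f : OnePoint ℂ → OnePoint ℂ => ContMDiff 𝓘(ℂ) 𝓘(ℂ) ω f) contMDiff_id
    (fun f g hf hg => hf.comp hg) (fun f hf => RiemannSphere.exists_fixedPoint hf) τ
    -- Component `i` depends only on coordinate `τ i`, so it may be evaluated on constant tuples.
    (fun i p => F.1 (fun _ => p) i)
    (fun i => (contMDiff_pi_apply i).comp (F.2.1.comp (contMDiff_pi_iff.2 fun _ => contMDiff_id)))
  refine ⟨x, funext fun i => ?_⟩
  rw [← hx i]
  exact hτ i _ _ rfl

end PPow

/-! ### The homomorphism to the automorphism group of `ℂ^s × ℍ^t` -/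

section Projection

open MulAction

variable {r s t : ℕ}

instance boundaryless_modelPow (n : ℕ) : (modelPow n).Boundaryless := by
  constructor
  exact Set.range_eq_univ.2 fun x => ⟨x, rfl⟩

/-- Each coordinate is a holomorphic function on a compact connected manifold, hence constant; `ℍ`
is included in `ℂ` for this. -/
theorem apply_eq_of_contMDiff {f : PPow r → CHProd s t} (hf : ContMDiff (modelPow r) (modelCH s t) ω f)
    (x y : PPow r) : f x = f y := by
  have h1 := contMDiff_pi_space.1 (contMDiff_fst.comp hf)
  have h2 := contMDiff_pi_iff.1 (contMDiff_snd.comp hf)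
  refine Prod.ext (funext fun i => ?_) (funext fun i => UpperHalfPlane.ext ?_)
  · exact ((h1 i).mdifferentiable (by simp)).apply_eq_of_compactSpace x y
  · exact ((UpperHalfPlane.contMDiff_coe.comp (h2 i)).mdifferentiable
      (by simp)).apply_eq_of_compactSpace x y

theorem snd_apply_eq (φ : AutPCH r s t) (x x' : PPow r) (y : CHProd s t) :
    (φ.1 (x, y)).2 = (φ.1 (x', y)).2 :=
  apply_eq_of_contMDiff (f := fun x => (φ.1 (x, y)).2)
    (contMDiff_snd.comp (φ.2.1.comp (contMDiff_id.prodMk contMDiff_const))) x x'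

/-- A point of `(ℙ¹)^r`. -/
def basePoint (r : ℕ) : PPow r := fun _ => OnePoint.infty

theorem contMDiff_snd_apply (φ : AutPCH r s t) :
    ContMDiff (modelCH s t) (modelCH s t) ω fun y => (φ.1 (basePoint r, y)).2 :=
  contMDiff_snd.comp (φ.2.1.comp (contMDiff_const.prodMk contMDiff_id))

theorem snd_apply_snd_apply (φ ψ : AutPCH r s t) (x x' : PPow r) (y : CHProd s t) :
    (φ.1 (x, (ψ.1 (x', y)).2)).2 = ((φ * ψ).1 (x, y)).2 := by
  rw [snd_apply_eq (φ * ψ) x x' y, snd_apply_eq φ x (ψ.1 (x', y)).1]; rfl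

/-- The automorphism of `ℂ^s × ℍ^t` induced by an automorphism of `(ℙ¹)^r × ℂ^s × ℍ^t`. -/
def projAut (φ : AutPCH r s t) : AutCH s t where
  val :=
    { toFun := fun y => (φ.1 (basePoint r, y)).2
      invFun := fun y => (φ⁻¹.1 (basePoint r, y)).2
      left_inv := fun y => by
        beta_reduce
        rw [snd_apply_snd_apply, inv_mul_cancel]; rfl
      right_inv := fun y => by
        beta_reduce
        rw [snd_apply_snd_apply, mul_inv_cancel]; rfl }
  property := ⟨contMDiff_snd_apply φ, contMDiff_snd_apply φ⁻¹⟩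

variable (r s t) in
/-- The homomorphism `Aut((ℙ¹)^r × ℂ^s × ℍ^t) → Aut(ℂ^s × ℍ^t)` compatible with the projection. -/
def projHom : AutPCH r s t →* AutCH s t :=
  MonoidHom.mk' projAut fun φ ψ => Subtype.ext <| Equiv.ext fun y =>
    (snd_apply_snd_apply φ ψ (basePoint r) (basePoint r) y).symm

theorem projHom_apply (φ : AutPCH r s t) (x : PCHProd r s t) :
    (projHom r s t φ).1 x.2 = (φ.1 x).2 :=
  snd_apply_eq φ (basePoint r) x.1 x.2

/-- An automorphism whose projection fixes a point has a fixed point over it. -/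
theorem exists_fixedPoint_of_projHom_apply_eq {φ : AutPCH r s t} {y : CHProd s t}
    (h : (projHom r s t φ).1 y = y) : ∃ x : PPow r, φ.1 (x, y) = (x, y) := by
  have key : ∀ ψ : AutPCH r s t, (projHom r s t ψ).1 y = y →
      ∀ x, ψ.1 (x, y) = ((ψ.1 (x, y)).1, y) := fun ψ hψ x =>
    Prod.ext rfl ((projHom_apply ψ (x, y)).symm.trans hψ)
  have hsmooth : ∀ ψ : AutPCH r s t,
      ContMDiff (modelPow r) (modelPow r) ω fun x => (ψ.1 (x, y)).1 := fun ψ =>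
    contMDiff_fst.comp (ψ.2.1.comp (contMDiff_id.prodMk contMDiff_const))
  have h' : (projHom r s t φ⁻¹).1 y = y := by
    rw [map_inv]
    conv_lhs => rw [← h]
    exact (projHom r s t φ).1.symm_apply_apply y
  -- Both `φ` and `φ⁻¹` preserve the fibre over `y`, so `φ` restricts to an automorphism of it.
  let F : PPow.Aut r :=
    ⟨{  toFun := fun x => (φ.1 (x, y)).1
        invFun := fun x => (φ⁻¹.1 (x, y)).1
        left_inv := fun x => by
          beta_reduce
          rw [← key φ h]
          exact congrArg Prod.fst (φ.1.symm_apply_apply (x, y))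
        right_inv := fun x => by
          beta_reduce
          rw [← key φ⁻¹ h']
          exact congrArg Prod.fst (φ.1.apply_symm_apply (x, y)) }, hsmooth φ, hsmooth φ⁻¹⟩
  obtain ⟨x, hx⟩ := PPow.exists_fixedPoint F
  exact ⟨x, (key φ h x).trans (Prod.ext hx rfl)⟩

theorem eq_one_of_projHom_apply_eq {Γ : Subgroup (AutPCH r s t)} [IsCancelSMul Γ (PCHProd r s t)]
    {γ : AutPCH r s t} (hγ : γ ∈ Γ) {y : CHProd s t} (h : (projHom r s t γ).1 y = y) : γ = 1 := by
  obtain ⟨x, hx⟩ := exists_fixedPoint_of_projHom_apply_eq h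
  exact congrArg Subtype.val
    (isCancelSMul_iff_eq_one_of_smul_eq.1 ‹_› (⟨γ, hγ⟩ : Γ) (x, y) hx)

theorem isCancelSMul_map_projHom (Γ : Subgroup (AutPCH r s t)) [IsCancelSMul Γ (PCHProd r s t)] :
    IsCancelSMul (Γ.map (projHom r s t)) (CHProd s t) := by
  rw [isCancelSMul_iff_eq_one_of_smul_eq]
  rintro ⟨_, γ, hγ, rfl⟩ y h
  refine Subtype.ext ?_
  change projHom r s t γ = 1
  rw [eq_one_of_projHom_apply_eq hγ h, map_one]

theorem injOn_projHom (Γ : Subgroup (AutPCH r s t)) [IsCancelSMul Γ (PCHProd r s t)] :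
    Set.InjOn (projHom r s t) Γ := by
  intro γ hγ γ' hγ' h
  -- The image of `γ⁻¹ * γ'` is the identity, so any point of the base serves as the fixed point.
  have h1 : γ⁻¹ * γ' = 1 := by
    refine eq_one_of_projHom_apply_eq (Γ := Γ) (Γ.mul_mem (Γ.inv_mem hγ) hγ')
      (y := (0, fun _ => UpperHalfPlane.I)) ?_
    rw [map_mul, map_inv, h, inv_mul_cancel]; rfl
  exact inv_mul_eq_one.1 h1

/-- Preimages of compact sets under the projection are compact, since the fibre is. An element
moving `K` into contact with `L` lifts to one doing so for the preimages, and these are finite in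
number. -/
theorem properlyDiscontinuousSMul_map_projHom (Γ : Subgroup (AutPCH r s t))
    [ProperlyDiscontinuousSMul Γ (PCHProd r s t)] :
    ProperlyDiscontinuousSMul (Γ.map (projHom r s t)) (CHProd s t) := by
  refine ⟨fun {K L} hK hL => ?_⟩
  have h1 := ProperlyDiscontinuousSMul.finite_disjoint_inter_image (Γ := Γ)
    ((isCompact_univ (X := PPow r)).prod hK) ((isCompact_univ (X := PPow r)).prod hL)
  refine (h1.image fun γ : Γ => (⟨projHom r s t γ, γ, γ.2, rfl⟩ : Γ.map (projHom r s t))).subset ?_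
  rintro ⟨_, γ, hγ, rfl⟩ h
  obtain ⟨_, ⟨y, hy, rfl⟩, hyL⟩ := h
  refine ⟨⟨γ, hγ⟩, ⟨γ.1 (basePoint r, y), ⟨(basePoint r, y), ⟨trivial, hy⟩, rfl⟩, trivial, ?_⟩, rfl⟩
  rw [← projHom_apply]
  exact hyL

end Projection

/-! ### The bundle structure on the quotient -/

section QuotientChart

open MulAction

variable {M : Type*} [TopologicalSpace M] [T2Space M] [LocallyCompactSpace M] [Nonempty M]
  {G : Type*} [Group G] [MulAction G M] [ProperlyDiscontinuousSMul G M] [ContinuousConstSMul G M]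
  [IsCancelSMul G M]

/-- The quotient map, restricted to an open set on which it is injective. -/
def quotientMkOn (V : Set M) (hV : IsOpen V)
    (hinj : Set.InjOn (Quotient.mk (orbitRel G M)) V) :
    OpenPartialHomeomorph M (orbitRel.Quotient G M) :=
  OpenPartialHomeomorph.ofContinuousOpen (hinj.toPartialEquiv _ _)
    (isLocalHomeomorph_orbit_mk M G).continuous.continuousOn
    (isLocalHomeomorph_orbit_mk M G).isOpenMap hV

variable {V : Set M} {hV : IsOpen V} {hinj : Set.InjOn (Quotient.mk (orbitRel G M)) V}

variable {𝕜 : Type*} [NontriviallyNormedField 𝕜] {E : Type*} [NormedAddCommGroup E]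
  [NormedSpace 𝕜 E] {H : Type*} [TopologicalSpace H] {I : ModelWithCorners 𝕜 E H}
  [ChartedSpace H M] {n : ℕ∞ω}

theorem contMDiffOn_quotientMkOn_symm [IsManifold I n M]
    (hG : ∀ g : G, ContMDiff I I n fun x : M => g • x) :
    ContMDiffOn I I n (quotientMkOn V hV hinj).symm (quotientMkOn V hV hinj).target := by
  intro y hy
  have hnhds := (quotientMkOn V hV hinj).open_target.mem_nhds hy
  refine (contMDiffAt_of_eventually_mk_eq hG
    ((quotientMkOn V hV hinj).symm.continuousAt hy) ?_).contMDiffWithinAt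
  filter_upwards [hnhds] with y' hy'
  exact (quotientMkOn V hV hinj).right_inv hy'

end QuotientChart

/-! ### Local trivializations of the induced map -/

section Bundle

open MulAction

variable {r s t : ℕ} (Γ : Subgroup (AutPCH r s t))

/-- The map of quotients induced by the projection. -/
def quotientProj : orbitRel.Quotient Γ (PCHProd r s t) →
    orbitRel.Quotient (Γ.map (projHom r s t)) (CHProd s t) :=
  Quotient.lift (fun x => Quotient.mk _ x.2) (by
    rintro _ x ⟨γ, rfl⟩
    refine Quotient.sound ⟨⟨projHom r s t γ, γ, γ.2, rfl⟩, ?_⟩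
    exact projHom_apply γ.1 x)

theorem quotientProj_mk (x : PCHProd r s t) :
    quotientProj Γ (Quotient.mk _ x) = Quotient.mk _ x.2 := rfl

theorem contMDiff_smul_holAut {E : Type*} [NormedAddCommGroup E] [NormedSpace ℂ E] {H : Type*}
    [TopologicalSpace H] {I : ModelWithCorners ℂ E H} {M : Type*} [TopologicalSpace M]
    [ChartedSpace H M] {Γ : Subgroup (HolAut I M)} (γ : Γ) : ContMDiff I I ω fun x : M => γ • x :=
  γ.1.2.1

theorem isHolomorphicFiberBundle_quotientProj [IsCancelSMul Γ (PCHProd r s t)]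
    [ProperlyDiscontinuousSMul Γ (PCHProd r s t)]
    [IsCancelSMul (Γ.map (projHom r s t)) (CHProd s t)]
    [ProperlyDiscontinuousSMul (Γ.map (projHom r s t)) (CHProd s t)] :
    IsHolomorphicFiberBundle (modelPCH r s t) (modelCH s t) (modelPow r) (PPow r)
      (quotientProj Γ) := by
  refine ⟨isManifold_quotient contMDiff_smul_holAut, isManifold_quotient contMDiff_smul_holAut,
    fun b => ?_⟩
  obtain ⟨y₀, rfl⟩ := Quotient.mk_surjective b
  obtain ⟨U, hU, hdisj⟩ := (isQuotientCoveringMap_quotientMk_of_properlyDiscontinuousSMul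
    (G := Γ.map (projHom r s t)) (E := CHProd s t)).disjoint y₀
  let V := interior U
  have hy₀ : y₀ ∈ V := mem_interior_iff_mem_nhds.2 hU
  have hV : ∀ γ : Γ.map (projHom r s t), ∀ y ∈ V, γ • y ∈ V → γ = 1 := fun γ y hy hγ =>
    hdisj γ ⟨γ • y, ⟨y, interior_subset hy, rfl⟩, interior_subset hγ⟩
  have hinj₂ : Set.InjOn (Quotient.mk (orbitRel (Γ.map (projHom r s t)) (CHProd s t))) V := by
    intro y hy y' hy' h
    obtain ⟨γ, rfl⟩ := Quotient.exact h
    change γ • y' = y'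
    rw [hV γ y' hy' hy, one_smul]
  -- If `γ` relates two points over `V`, its image is trivial by the choice of `V`, and then `γ` is
  -- trivial because `projHom` is injective on `Γ`.
  have hinj₁ : Set.InjOn (Quotient.mk (orbitRel Γ (PCHProd r s t))) (Set.univ ×ˢ V) := by
    rintro x ⟨-, hx⟩ x' ⟨-, hx'⟩ h
    obtain ⟨γ, rfl⟩ := Quotient.exact h
    have h1 := hV ⟨projHom r s t γ, γ, γ.2, rfl⟩ x'.2 hx' (by
      have : (projHom r s t γ.1).1 x'.2 ∈ V := by rw [projHom_apply]; exact hx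
      exact this)
    have h2 : projHom r s t γ = projHom r s t 1 := by rw [map_one]; exact congrArg Subtype.val h1
    have h3 : γ = 1 := Subtype.ext (injOn_projHom Γ γ.2 Γ.one_mem h2)
    change γ • x' = x'
    rw [h3, one_smul]
  let ψ := quotientMkOn _ (isOpen_univ.prod isOpen_interior) hinj₁
  let χ := quotientMkOn _ isOpen_interior hinj₂
  -- Lift to `(ℙ¹)^r × V`, swap the factors, and pass to the quotient in `V`.
  let e := (ψ.symm.trans (Homeomorph.prodComm (PPow r) (CHProd s t)).toOpenPartialHomeomorph).trans
    (χ.prod (OpenPartialHomeomorph.refl (PPow r)))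
  -- An orbit whose projection meets `V` can be moved by some `γ` into `(ℙ¹)^r × V`, so the chart
  -- covers the full preimage.
  have hsource : e.source = quotientProj Γ ⁻¹' (Quotient.mk _ '' V) := by
    ext z
    constructor
    · rintro ⟨⟨⟨x, ⟨-, hx⟩, rfl⟩, -⟩, -⟩
      exact ⟨x.2, hx, rfl⟩
    · obtain ⟨x, rfl⟩ := Quotient.mk_surjective z
      rintro ⟨y, hy, h⟩
      obtain ⟨⟨_, γ, hγ, rfl⟩, h⟩ := Quotient.exact h
      have hy' : (γ.1 x).2 ∈ V := by
        rw [← projHom_apply]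
        have : (projHom r s t γ).1 x.2 = y := h
        rwa [this]
      have hz : Quotient.mk (orbitRel Γ (PCHProd r s t)) x ∈ ψ.target :=
        ⟨γ.1 x, ⟨trivial, hy'⟩, Quotient.sound ⟨⟨γ, hγ⟩, rfl⟩⟩
      exact ⟨⟨hz, trivial⟩, (ψ.map_target hz).2, trivial⟩
  have htarget : e.target = (Quotient.mk _ '' V) ×ˢ Set.univ := by
    ext z
    constructor
    · rintro ⟨⟨hz, -⟩, -⟩
      exact ⟨hz, trivial⟩
    · rintro ⟨hz, -⟩
      exact ⟨⟨hz, trivial⟩, trivial, trivial, χ.map_target hz⟩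
  let T : Bundle.Trivialization (PPow r) (quotientProj Γ) :=
    { e with
      baseSet := Quotient.mk _ '' V
      open_baseSet := χ.open_target
      source_eq := hsource
      target_eq := htarget
      proj_toFun := by
        rintro z ⟨⟨hz, -⟩, -⟩
        change quotientProj Γ (ψ (ψ.symm z)) = _
        rw [ψ.right_inv hz] }
  refine ⟨T, ⟨y₀, hy₀, rfl⟩, ?_, ?_⟩
  · have h1 : ContMDiffOn (modelPCH r s t) (modelPCH r s t) ω ψ.symm ψ.target :=
      contMDiffOn_quotientMkOn_symm contMDiff_smul_holAut
    have h2 : ContMDiffOn (modelPCH r s t) (modelPCH r s t) ω ψ.symm e.source :=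
      h1.mono fun z hz => hz.1.1
    exact ((contMDiff_quotient_mk contMDiff_smul_holAut).comp_contMDiffOn
      (contMDiff_snd.comp_contMDiffOn h2)).prodMk (contMDiff_fst.comp_contMDiffOn h2)
  · have h1 : ContMDiffOn (modelCH s t) (modelCH s t) ω χ.symm χ.target :=
      contMDiffOn_quotientMkOn_symm contMDiff_smul_holAut
    have h2 : ContMDiffOn ((modelCH s t).prod (modelPow r)) (modelCH s t) ω
        (fun z => χ.symm z.1) e.target :=
      h1.comp contMDiff_fst.contMDiffOn fun z hz => hz.1.1
    exact (contMDiff_quotient_mk contMDiff_smul_holAut).comp_contMDiffOn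
      (contMDiff_snd.contMDiffOn.prodMk h2)

end Bundle

end

theorem proposition2p2 (r s t : ℕ) :
    ∃ Φ : AutPCH r s t →* AutCH s t,
      -- `Φ` is the natural homomorphism: it is compatible with the second projection
      (∀ (φ : AutPCH r s t) (x : PCHProd r s t), (Φ φ).1 x.2 = (φ.1 x).2) ∧
      -- freely acting subgroups embed, and their images act freely
      (∀ Γ : Subgroup (AutPCH r s t), IsCancelSMul Γ (PCHProd r s t) →
        Set.InjOn Φ Γ ∧ IsCancelSMul (Γ.map Φ) (CHProd s t)) ∧
      -- images of properly discontinuous groups are properly discontinuous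
      (∀ Γ : Subgroup (AutPCH r s t), ProperlyDiscontinuousSMul Γ (PCHProd r s t) →
        ProperlyDiscontinuousSMul (Γ.map Φ) (CHProd s t)) ∧
      -- for free and properly discontinuous `Γ`, the projection of quotient manifolds is a bundle
      (∀ (Γ : Subgroup (AutPCH r s t)) [IsCancelSMul Γ (PCHProd r s t)]
          [ProperlyDiscontinuousSMul Γ (PCHProd r s t)],
        ∃ (_ : IsCancelSMul (Γ.map Φ) (CHProd s t))
          (_ : ProperlyDiscontinuousSMul (Γ.map Φ) (CHProd s t))
          (π : MulAction.orbitRel.Quotient Γ (PCHProd r s t) →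
            MulAction.orbitRel.Quotient (Γ.map Φ) (CHProd s t)),
          (∀ x : PCHProd r s t, π (Quotient.mk _ x) = Quotient.mk _ x.2) ∧
          IsHolomorphicFiberBundle (modelPCH r s t) (modelCH s t) (modelPow r) (PPow r) π) := by
  refine ⟨projHom r s t, projHom_apply, fun Γ _ => ⟨injOn_projHom Γ, isCancelSMul_map_projHom Γ⟩,
    fun Γ _ => properlyDiscontinuousSMul_map_projHom Γ, fun Γ _ _ => ?_⟩
  have h1 := isCancelSMul_map_projHom Γ
  have h2 := properlyDiscontinuousSMul_map_projHom Γ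
  exact ⟨h1, h2, quotientProj Γ, quotientProj_mk Γ, isHolomorphicFiberBundle_quotientProj Γ⟩
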